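/- Let $\Omega \subset \mathbb{R}^n$ be open. A function $f \in L^1(\Omega)$ belongs to $BV(\Omega)$ if there is an $\mathbb{R}^n$-valued measure $Df = (D_1 f, \ldots, D_n f)$ on the Borel subsets of $\Omega$, of finite total variation, with $\int_\Omega \varphi \, dD_i f = -\int_\Omega f \, \frac{\partial \varphi}{\partial x_i} \, dx$ for all $\varphi \in C_c^\infty(\Omega)$ and $i = 1, \ldots, n$. Such a $Df$ is unique, and $\|Df\|$ denotes its total variation measure with respect to the Euclidean norm; the notation $Du$, $\|Du\|$ is used likewise for any locally integrable $u$ on $\Omega$ whose distributional partial derivatives are such measures. For Lebesgue measurable $E \subset \mathbb{R}^n$ the perimeter of $E$ in $\Omega$ is $$P(E;\Omega) = \sup\Big\{ \int_{E \cap \Omega} \operatorname{div} \Phi \, dx : \Phi \in C_c^\infty(\Omega;\mathbb{R}^n),\ \sup_x |\Phi(x)| \le 1 \Big\} \in [0,\infty],$$ and $E$ has finite perimeter in $\Omega$ if $P(E;\Omega) < \infty$. **Coarea formula for BV.** Let $f \in BV(\Omega)$ and, for $t \in \mathbb{R}$, let $\Omega_t(f) = \{x \in \Omega : f(x) > t\}$.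 Then for almost every $t$ the set $\Omega_t(f)$ is Lebesgue measurable and has finite perimeter in $\Omega$, the distributional gradient $D\chi_{\Omega_t(f)}$ is an $\mathbb{R}^n$-valued measure on $\Omega$ of finite total variation, and $\|D\chi_{\Omega_t(f)}\|(\Omega) = P(\Omega_t(f);\Omega)$. Moreover, the function $t \mapsto P(\Omega_t(f);\Omega)$ is Lebesgue measurable, and $$\|Df\|(\Omega) = \int_{\mathbb{R}} P(\Omega_t(f);\Omega) \, dt = \int_{\mathbb{R}} \|D\chi_{\Omega_t(f)}\|(\Omega) \, dt .$$ -/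

import Mathlib

open MeasureTheory Set
open scoped ENNReal ContDiff

noncomputable section

namespace BVSpace

/-- The divergence `∑ i, ∂Φ_i/∂x_i` of a vector field on `ℝⁿ`. -/
def divergence {n : ℕ} (Φ : EuclideanSpace ℝ (Fin n) → EuclideanSpace ℝ (Fin n))
    (x : EuclideanSpace ℝ (Fin n)) : ℝ :=
  ∑ i : Fin n, (fderiv ℝ Φ x (EuclideanSpace.single i 1)) i

/-- The space `C_c^∞(Ω; F)` of test functions: smooth on `ℝⁿ`, with compact support inside `Ω`. -/
structure IsTestFunction {n : ℕ} {F : Type*} [NormedAddCommGroup F] [NormedSpace ℝ F]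
    (Ω : Set (EuclideanSpace ℝ (Fin n))) (φ : EuclideanSpace ℝ (Fin n) → F) : Prop where
  contDiff : ContDiff ℝ ∞ φ
  hasCompactSupport : HasCompactSupport φ
  tsupport_subset : tsupport φ ⊆ Ω

/-- The vector measure `D` is the distributional gradient of `u` in `Ω`: it has finite total
variation in `Ω`, and `∫_Ω φ dD_i = - ∫_Ω u ∂φ/∂x_i` for every `φ ∈ C_c^∞(Ω)` and every `i`.
Only the values of `D` on Borel subsets of `Ω` matter. -/
structure IsGradientMeasure {n : ℕ} (Ω : Set (EuclideanSpace ℝ (Fin n)))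
    (u : EuclideanSpace ℝ (Fin n) → ℝ)
    (D : VectorMeasure (EuclideanSpace ℝ (Fin n)) (EuclideanSpace ℝ (Fin n))) : Prop where
  variation_lt_top : D.variation Ω < ⊤
  integral_eq : ∀ φ : EuclideanSpace ℝ (Fin n) → ℝ, IsTestFunction Ω φ → ∀ i : Fin n,
    (∫ᵛ x in Ω, φ x ∂•D) i
      = - ∫ x in Ω, u x * fderiv ℝ φ x (EuclideanSpace.single i 1)

/-- `f ∈ BV(Ω)`: `f ∈ L¹(Ω)`, and the distributional partial derivatives of `f` are finite signed
measures in `Ω`, of finite total variation. -/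
def MemBV {n : ℕ} (Ω : Set (EuclideanSpace ℝ (Fin n)))
    (f : EuclideanSpace ℝ (Fin n) → ℝ) : Prop :=
  IntegrableOn f Ω ∧
    ∃ D : VectorMeasure (EuclideanSpace ℝ (Fin n)) (EuclideanSpace ℝ (Fin n)),
      IsGradientMeasure Ω f D

/-- The variation of `u` in `Ω`: the supremum of `∫_Ω u div Φ` over all `Φ ∈ C_c^∞(Ω; ℝⁿ)` with
`‖Φ‖_∞ ≤ 1`. The choice `Φ = 0` shows that it is at least `0`, so it is a supremum in `[0, ∞]`. -/
def variationIn {n : ℕ} (Ω : Set (EuclideanSpace ℝ (Fin n)))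
    (u : EuclideanSpace ℝ (Fin n) → ℝ) : ℝ≥0∞ :=
  ⨆ (Φ : EuclideanSpace ℝ (Fin n) → EuclideanSpace ℝ (Fin n))
    (_ : IsTestFunction Ω Φ ∧ ∀ x, ‖Φ x‖ ≤ 1),
    ENNReal.ofReal (∫ x in Ω, u x * divergence Φ x)

/-- The perimeter `P(E; Ω)`: the variation in `Ω` of the characteristic function of `E`. -/
def perimeter {n : ℕ} (E Ω : Set (EuclideanSpace ℝ (Fin n))) : ℝ≥0∞ :=
  variationIn Ω (E.indicator fun _ => 1)

/-- `E` is Lebesgue measurable and has finite perimeter in `Ω`. -/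
def HasFinitePerimeter {n : ℕ} (E Ω : Set (EuclideanSpace ℝ (Fin n))) : Prop :=
  NullMeasurableSet E ∧ perimeter E Ω < ⊤

/-- The superlevel set `Ω_t(f) = {x ∈ Ω : f(x) > t}`. -/
def superlevel {n : ℕ} (Ω : Set (EuclideanSpace ℝ (Fin n)))
    (f : EuclideanSpace ℝ (Fin n) → ℝ) (t : ℝ) : Set (EuclideanSpace ℝ (Fin n)) :=
  {x ∈ Ω | t < f x}

end BVSpace

end

/-!
The proof compares three numbers: `‖Df‖(Ω)`, the variation
`sup {∫ f div Φ : Φ ∈ C_c^∞(Ω; ℝⁿ), |Φ| ≤ 1}` of `f`, and `∫ P(Ω_t(f); Ω) dt`, and shows that each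
of the first two is at most the next one and that the third is at most the first.

*Total variation of the gradient and variation of the function*
(`IsGradientMeasure.variation_le_variationIn`). Given disjoint Borel sets on which `Df` almost
attains its total variation, inner regularity replaces them by disjoint compact sets; smooth cutoffs
around these, multiplied by unit vectors against the corresponding values of `Df`, form an
admissible test field.

*Variation of the function and perimeters* (`variationIn_le_lintegral_perimeter`). By the layer-cake
formula and Fubini's theorem, `∫ f div Φ` is the integral over all `t` of `∫_{Ω_t(f)} div Φ`;
negative levels need no separate treatment because `∫ div Φ = 0`.

*Perimeters and total variation of the gradient* (`IsGradientMeasure.lintegral_perimeter_le`). Let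
`f_k` be mollifications of `f` and `H_k` smooth approximations of the Heaviside function. The
functions `H_k (f_k - t)` converge to the characteristic function of `Ω_t(f)` for almost every `t`.
Their gradients are `H_k' (f_k - t) ∇f_k`, whose integral over all `t` is `|∇f_k|` because
`∫ H_k' = 1`, and the integral of `|∇f_k|` over the points at distance more than `1 / (k + 1)` from
the complement of `Ω` is at most `‖Df‖(Ω)`, because `∇f_k` is there the mollification of the measure
`Df`. Fatou's lemma concludes. The smoothing of the characteristic functions makes any coarea
formula for smooth functions unnecessary.

*Measurability* (`aemeasurable_perimeter_superlevel`). If `{f = t}` is a null set, which fails for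
at most countably many `t`, every `∫_{Ω_s(f)} div Φ` is continuous in `s` at `t`, so that the perimeter
is lower semicontinuous off a countable set.

*Gradients of the superlevel sets* (`exists_isGradientMeasure`). A function of finite variation has
a gradient measure by a Riesz representation theorem. The variation of the functional
`Φ ↦ ∫ u div Φ` on small open sets defines a content, hence a finite measure `μ`; dyadic truncation
of `|Φ|` bounds the functional by `8 ∫ |Φ| dμ` (`IsBoundedFunctional.le_integral_norm`). It is
therefore bounded in `L²(μ)`, and the Fréchet-Riesz theorem gives it a density with respect to `μ`.
-/

namespace BVSpace

section

variable {n : ℕ} {F : Type*} [NormedAddCommGroup F] [NormedSpace ℝ F]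
  {Ω U : Set (EuclideanSpace ℝ (Fin n))}

/-! ### Test functions and the divergence -/

namespace IsTestFunction

variable {φ ψ : EuclideanSpace ℝ (Fin n) → F}

lemma zero : IsTestFunction Ω (0 : EuclideanSpace ℝ (Fin n) → F) where
  contDiff := contDiff_const
  hasCompactSupport := HasCompactSupport.zero
  tsupport_subset := by simp [tsupport]

lemma add (hφ : IsTestFunction Ω φ) (hψ : IsTestFunction Ω ψ) : IsTestFunction Ω (φ + ψ) where
  contDiff := hφ.contDiff.add hψ.contDiff
  hasCompactSupport := hφ.hasCompactSupport.add hψ.hasCompactSupport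
  tsupport_subset := (tsupport_add φ ψ).trans
    (union_subset hφ.tsupport_subset hψ.tsupport_subset)

/-- Multiplying a test function by a smooth function gives a test function; the open set may be
shrunk to any set containing the support of the product. -/
lemma smooth_smul (hφ : IsTestFunction Ω φ) {η : EuclideanSpace ℝ (Fin n) → ℝ}
    (hη : ContDiff ℝ ∞ η) (hU : tsupport η ∩ tsupport φ ⊆ U) :
    IsTestFunction U (fun x => η x • φ x) where
  contDiff := hη.smul hφ.contDiff
  hasCompactSupport := hφ.hasCompactSupport.smul_left
  tsupport_subset := (subset_inter (tsupport_smul_subset_left η φ)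
    (tsupport_smul_subset_right η φ)).trans hU

lemma const_smul (hφ : IsTestFunction Ω φ) (c : ℝ) : IsTestFunction Ω (c • φ) :=
  hφ.smooth_smul (η := fun _ => c) contDiff_const (inter_subset_right.trans hφ.tsupport_subset)

lemma mono (hφ : IsTestFunction Ω φ) (h : Ω ⊆ U) : IsTestFunction U φ :=
  ⟨hφ.contDiff, hφ.hasCompactSupport, hφ.tsupport_subset.trans h⟩

lemma clm_comp {G : Type*} [NormedAddCommGroup G] [NormedSpace ℝ G] (hφ : IsTestFunction Ω φ)
    (A : F →L[ℝ] G) : IsTestFunction Ω (fun x => A (φ x)) where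
  contDiff := A.contDiff.comp hφ.contDiff
  hasCompactSupport := hφ.hasCompactSupport.comp_left (map_zero A)
  tsupport_subset := (closure_mono (Function.support_comp_subset (map_zero A) φ)).trans
    hφ.tsupport_subset

lemma finset_sum {ι : Type*} (s : Finset ι) {φ : ι → EuclideanSpace ℝ (Fin n) → F}
    (hφ : ∀ i ∈ s, IsTestFunction Ω (φ i)) : IsTestFunction Ω (∑ i ∈ s, φ i) := by
  classical
  induction s using Finset.induction_on with
  | empty => simpa using zero
  | insert a s ha ih =>
    rw [Finset.sum_insert ha]
    exact (hφ a (by simp)).add (ih fun i hi => hφ i (by simp [hi]))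

lemma differentiable (hφ : IsTestFunction Ω φ) : Differentiable ℝ φ :=
  hφ.contDiff.differentiable (by simp)

lemma continuous (hφ : IsTestFunction Ω φ) : Continuous φ := hφ.contDiff.continuous

lemma eq_zero_of_notMem (hφ : IsTestFunction Ω φ) {x : EuclideanSpace ℝ (Fin n)} (hx : x ∉ Ω) :
    φ x = 0 :=
  image_eq_zero_of_notMem_tsupport fun h => hx (hφ.tsupport_subset h)

lemma continuous_fderiv (hφ : IsTestFunction Ω φ) : Continuous (fderiv ℝ φ) :=
  hφ.contDiff.continuous_fderiv (by simp)

end IsTestFunction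

/-- Smooth Urysohn lemma: a cutoff function that equals `1` near a compact set. -/
lemma exists_isTestFunction_eq_one_nhdsSet {K : Set (EuclideanSpace ℝ (Fin n))}
    (hK : IsCompact K) (hU : IsOpen U) (hKU : K ⊆ U) :
    ∃ φ : EuclideanSpace ℝ (Fin n) → ℝ, IsTestFunction U φ ∧
      (∀ᶠ x in nhdsSet K, φ x = 1) ∧ ∀ x, φ x ∈ Icc 0 1 := by
  obtain ⟨K', hK', hKK', hK'U⟩ := exists_compact_between hK hU hKU
  obtain ⟨f, hf0, hf1, hf⟩ := exists_contMDiffMap_zero_one_nhds_of_isClosed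
    (modelWithCornersSelf ℝ (EuclideanSpace ℝ (Fin n))) (n := ⊤)
    isOpen_interior.isClosed_compl hK.isClosed
    (disjoint_compl_left_iff_subset.2 hKK')
  have hsupp : tsupport f ⊆ K' := closure_minimal (fun x hx => by
    by_contra h
    exact hx (hf0.self_of_nhdsSet x fun h' => h (interior_subset h'))) hK'.isClosed
  exact ⟨f, ⟨f.contMDiff.contDiff, hK'.of_isClosed_subset (isClosed_tsupport _) hsupp,
    hsupp.trans hK'U⟩, hf1, hf⟩

variable {Φ Ψ : EuclideanSpace ℝ (Fin n) → EuclideanSpace ℝ (Fin n)}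

lemma divergence_add (hΦ : Differentiable ℝ Φ) (hΨ : Differentiable ℝ Ψ)
    (x : EuclideanSpace ℝ (Fin n)) :
    divergence (Φ + Ψ) x = divergence Φ x + divergence Ψ x := by
  simp [divergence, fderiv_add (hΦ x) (hΨ x), Finset.sum_add_distrib]

lemma divergence_const_smul (c : ℝ) (x : EuclideanSpace ℝ (Fin n)) :
    divergence (c • Φ) x = c * divergence Φ x := by
  simp [divergence, fderiv_const_smul_field, Finset.mul_sum]

lemma divergence_smul_const {φ : EuclideanSpace ℝ (Fin n) → ℝ} (hφ : Differentiable ℝ φ)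
    (v x : EuclideanSpace ℝ (Fin n)) :
    divergence (fun y => φ y • v) x =
      ∑ i, v i * fderiv ℝ φ x (EuclideanSpace.single i 1) := by
  simp [divergence, fderiv_smul_const (hφ x), mul_comm]

lemma IsTestFunction.continuous_divergence (hΦ : IsTestFunction Ω Φ) :
    Continuous (divergence Φ) := by
  unfold divergence
  have := hΦ.continuous_fderiv
  fun_prop

lemma divergence_eq_zero_of_notMem_tsupport {x : EuclideanSpace ℝ (Fin n)}
    (hx : x ∉ tsupport Φ) : divergence Φ x = 0 := by
  have : fderiv ℝ Φ x = 0 := image_eq_zero_of_notMem_tsupport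
    fun h => hx (tsupport_fderiv_subset ℝ h)
  simp [divergence, this]

lemma IsTestFunction.hasCompactSupport_divergence (hΦ : IsTestFunction Ω Φ) :
    HasCompactSupport (divergence Φ) :=
  HasCompactSupport.intro hΦ.hasCompactSupport fun _ => divergence_eq_zero_of_notMem_tsupport

lemma IsTestFunction.integrable_divergence (hΦ : IsTestFunction Ω Φ) :
    Integrable (divergence Φ) :=
  hΦ.continuous_divergence.integrable_of_hasCompactSupport hΦ.hasCompactSupport_divergence

lemma _root_.MeasureTheory.LocallyIntegrableOn.integrableOn_mul_of_hasCompactSupport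
    {u g : EuclideanSpace ℝ (Fin n) → ℝ} (hu : LocallyIntegrableOn u Ω) (hg : Continuous g)
    (hgc : HasCompactSupport g) (hgΩ : tsupport g ⊆ Ω) :
    Integrable (fun x => u x * g x) := by
  have h1 : IntegrableOn u (tsupport g) := hu.integrableOn_compact_subset hgΩ hgc
  have h2 : IntegrableOn (fun x => u x * g x) (tsupport g) :=
    h1.mul_continuousOn hg.continuousOn hgc
  refine (integrableOn_iff_integrable_of_support_subset fun x hx => ?_).1 h2
  exact subset_tsupport g fun h => hx (by simp [h])

lemma IsTestFunction.integrable_mul_divergence {u : EuclideanSpace ℝ (Fin n) → ℝ}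
    (hu : LocallyIntegrableOn u Ω) (hΦ : IsTestFunction Ω Φ) :
    Integrable (fun x => u x * divergence Φ x) :=
  hu.integrableOn_mul_of_hasCompactSupport hΦ.continuous_divergence hΦ.hasCompactSupport_divergence
    ((closure_minimal (fun x hx => by
      by_contra h
      exact hx (divergence_eq_zero_of_notMem_tsupport h)) (isClosed_tsupport Φ)).trans
      hΦ.tsupport_subset)

lemma IsTestFunction.setIntegral_mul_divergence (u : EuclideanSpace ℝ (Fin n) → ℝ)
    (hΦ : IsTestFunction Ω Φ) :
    ∫ x in Ω, u x * divergence Φ x = ∫ x, u x * divergence Φ x :=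
  setIntegral_eq_integral_of_forall_compl_eq_zero fun x hx => by
    rw [divergence_eq_zero_of_notMem_tsupport fun h => hx (hΦ.tsupport_subset h), mul_zero]

/-- Integration by parts: `∫ w div Φ = - ∫ ⟨∇w, Φ⟩`. -/
lemma IsTestFunction.integral_mul_divergence {w : EuclideanSpace ℝ (Fin n) → ℝ}
    (hw : ContDiff ℝ 1 w) (hΦ : IsTestFunction Ω Φ) :
    ∫ x, w x * divergence Φ x = - ∫ x, fderiv ℝ w x (Φ x) := by
  have hdw : Continuous (fderiv ℝ w) := hw.continuous_fderiv (by simp)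
  have hcomp (i : Fin n) : IsTestFunction Ω (fun x => Φ x i) :=
    hΦ.clm_comp (EuclideanSpace.proj i)
  have hfd (i : Fin n) (x : EuclideanSpace ℝ (Fin n)) :
      fderiv ℝ Φ x (EuclideanSpace.single i 1) i
        = fderiv ℝ (fun x => Φ x i) x (EuclideanSpace.single i 1) := by
    have h := ((EuclideanSpace.proj i : EuclideanSpace ℝ (Fin n) →L[ℝ] ℝ).hasFDerivAt.comp x
      (hΦ.differentiable x).hasFDerivAt).fderiv
    have h' : fderiv ℝ (fun x => Φ x i) x =
        (EuclideanSpace.proj i : EuclideanSpace ℝ (Fin n) →L[ℝ] ℝ).comp (fderiv ℝ Φ x) := h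
    rw [h']; rfl
  have hsum (x : EuclideanSpace ℝ (Fin n)) :
      fderiv ℝ w x (Φ x) = ∑ i, fderiv ℝ w x (EuclideanSpace.single i 1) * Φ x i := by
    have : Φ x = ∑ i, Φ x i • EuclideanSpace.single i (1 : ℝ) := by
      ext j; simp [Finset.sum_apply, Pi.single_apply]
    conv_lhs => rw [this]
    simp [mul_comm]
  have hi1 (i : Fin n) : Integrable fun x =>
      fderiv ℝ w x (EuclideanSpace.single i 1) * Φ x i :=
    Continuous.integrable_of_hasCompactSupport
      ((hdw.clm_apply continuous_const).mul (hcomp i).continuous)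
      (hcomp i).hasCompactSupport.mul_left
  have hi2 (i : Fin n) : Integrable fun x =>
      w x * fderiv ℝ (fun x => Φ x i) x (EuclideanSpace.single i 1) :=
    Continuous.integrable_of_hasCompactSupport
      (hw.continuous.mul ((hcomp i).continuous_fderiv.clm_apply continuous_const))
      (((hcomp i).hasCompactSupport.fderiv_apply ℝ _).mul_left)
  have hi3 (i : Fin n) : Integrable fun x => w x * Φ x i :=
    Continuous.integrable_of_hasCompactSupport (hw.continuous.mul (hcomp i).continuous)
      (hcomp i).hasCompactSupport.mul_left
  simp_rw [hsum, divergence, hfd, Finset.mul_sum]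
  rw [integral_finsetSum _ fun i _ => hi1 i, integral_finsetSum _ fun i _ => hi2 i,
    ← Finset.sum_neg_distrib]
  refine Finset.sum_congr rfl fun i _ => ?_
  exact integral_mul_fderiv_eq_neg_fderiv_mul_of_integrable (hi1 i) (hi2 i) (hi3 i)
    (fun x _ => hw.differentiable (by simp) x) (fun x _ => (hcomp i).differentiable x)

lemma IsTestFunction.integral_divergence_eq_zero (hΦ : IsTestFunction Ω Φ) :
    ∫ x, divergence Φ x = 0 := by
  simpa using hΦ.integral_mul_divergence (w := fun _ => 1) contDiff_const

lemma variationIn_congr_ae {u v : EuclideanSpace ℝ (Fin n) → ℝ}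
    (h : u =ᵐ[volume.restrict Ω] v) : variationIn Ω u = variationIn Ω v := by
  unfold variationIn
  refine iSup_congr fun Φ => iSup_congr fun _ => congrArg _
    (integral_congr_ae (h.mono fun x hx => ?_))
  simp only [hx]

lemma le_variationIn (u : EuclideanSpace ℝ (Fin n) → ℝ) (hΦ : IsTestFunction Ω Φ)
    (h1 : ∀ x, ‖Φ x‖ ≤ 1) :
    ENNReal.ofReal (∫ x in Ω, u x * divergence Φ x) ≤ variationIn Ω u :=
  le_iSup₂_of_le Φ ⟨hΦ, h1⟩ le_rfl

lemma IsGradientMeasure.congr_ae {u v : EuclideanSpace ℝ (Fin n) → ℝ}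
    {D : VectorMeasure (EuclideanSpace ℝ (Fin n)) (EuclideanSpace ℝ (Fin n))}
    (h : u =ᵐ[volume.restrict Ω] v) (hD : IsGradientMeasure Ω u D) :
    IsGradientMeasure Ω v D where
  variation_lt_top := hD.variation_lt_top
  integral_eq φ hφ i := by
    rw [hD.integral_eq φ hφ i]
    exact congrArg Neg.neg (integral_congr_ae (h.mono fun x hx => by simp only [hx]))

end

section

variable {n : ℕ} {Ω : Set (EuclideanSpace ℝ (Fin n))}

/-! ### The total variation of a gradient measure is at most the variation of the function -/

/-- Testing the gradient against `φ • v` for a constant vector `v`. -/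
lemma IsGradientMeasure.integral_mul_divergence_smul_const
    {u : EuclideanSpace ℝ (Fin n) → ℝ}
    {D : VectorMeasure (EuclideanSpace ℝ (Fin n)) (EuclideanSpace ℝ (Fin n))}
    (hD : IsGradientMeasure Ω u D) (hu : LocallyIntegrableOn u Ω)
    {φ : EuclideanSpace ℝ (Fin n) → ℝ} (hφ : IsTestFunction Ω φ) (v : EuclideanSpace ℝ (Fin n)) :
    ∫ x in Ω, u x * divergence (fun y => φ y • v) x
      = - inner ℝ v (∫ᵛ x in Ω, φ x ∂•D) := by
  have hint (i : Fin n) : Integrable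
      (fun x => u x * fderiv ℝ φ x (EuclideanSpace.single i 1)) :=
    hu.integrableOn_mul_of_hasCompactSupport (hφ.continuous_fderiv.clm_apply continuous_const)
      (hφ.hasCompactSupport.fderiv_apply ℝ _)
      ((tsupport_fderiv_apply_subset ℝ _).trans hφ.tsupport_subset)
  have h (x : EuclideanSpace ℝ (Fin n)) : u x * divergence (fun y => φ y • v) x =
      ∑ i, v i * (u x * fderiv ℝ φ x (EuclideanSpace.single i 1)) := by
    rw [divergence_smul_const hφ.differentiable, Finset.mul_sum]
    exact Finset.sum_congr rfl fun i _ => by ring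
  simp_rw [h]
  rw [integral_finsetSum _ fun i _ => ((hint i).const_mul _).integrableOn]
  simp_rw [integral_const_mul]
  rw [PiLp.inner_apply, ← Finset.sum_neg_distrib]
  refine Finset.sum_congr rfl fun i _ => ?_
  simp [hD.integral_eq φ hφ i, mul_comm]

/-- A compact set `K` and the complement of an open neighbourhood `U` of it are separated by a
smooth cutoff function whose integral against `D` is within `D.variation (U \ K)` of `D K`. -/
lemma exists_cutoff_norm_integral_sub_le
    (D : VectorMeasure (EuclideanSpace ℝ (Fin n)) (EuclideanSpace ℝ (Fin n)))
    [IsFiniteMeasure D.variation] {K U : Set (EuclideanSpace ℝ (Fin n))}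
    (hK : IsCompact K) (hU : IsOpen U) (hKU : K ⊆ U) :
    ∃ φ : EuclideanSpace ℝ (Fin n) → ℝ, IsTestFunction U φ ∧ (∀ x, φ x ∈ Icc 0 1) ∧
      ‖(∫ᵛ x, φ x ∂•D) - D K‖ ≤ D.variation.real (U \ K) := by
  obtain ⟨φ, hφ, hφ1, hφ01⟩ := exists_isTestFunction_eq_one_nhdsSet hK hU hKU
  refine ⟨φ, hφ, hφ01, ?_⟩
  have hm : MeasurableSet (U \ K) := hU.measurableSet.diff hK.measurableSet
  have hφi : D.Integrable φ := hφ.continuous.integrable_of_hasCompactSupport hφ.hasCompactSupport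
  have hKi : D.Integrable (K.indicator fun _ => (1 : ℝ)) :=
    (integrable_const _).indicator hK.measurableSet
  have hKint : ∫ᵛ x, K.indicator (fun _ => (1 : ℝ)) x ∂•D = D K := by
    rw [VectorMeasure.integral_indicator hK.measurableSet, VectorMeasure.integral_const]
    simp
  rw [← hKint, ← VectorMeasure.integral_fun_sub hφi hKi]
  refine VectorMeasure.norm_integral_le_integral_norm.trans ?_
  have hle : ∀ x, ‖φ x - K.indicator (fun _ => (1 : ℝ)) x‖ ≤ (U \ K).indicator (fun _ => 1) x := by
    intro x
    by_cases hx : x ∈ K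
    · simp [hx, hφ1.self_of_nhdsSet x hx]
    by_cases hxU : x ∈ U
    · simp [hx, hxU, abs_of_nonneg (hφ01 x).1, (hφ01 x).2]
    · simp [hx, hxU, hφ.eq_zero_of_notMem hxU]
  have hB : ‖ContinuousLinearMap.lsmul ℝ ℝ (E := EuclideanSpace ℝ (Fin n))‖ ≤ 1 :=
    ContinuousLinearMap.opNorm_lsmul_le
  calc _ ≤ 1 * ∫ x, ‖φ x - K.indicator (fun _ => (1 : ℝ)) x‖ ∂D.variation := by gcongr
    _ ≤ ∫ x, (U \ K).indicator (fun _ => 1) x ∂D.variation := by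
      rw [one_mul]
      exact integral_mono (hφi.sub hKi).norm ((integrable_const _).indicator hm) hle
    _ = _ := by rw [integral_indicator hm]; simp

/-- The total variation of a gradient measure is almost attained by a test field that is constant in
direction near each of finitely many disjoint compact sets. -/
theorem IsGradientMeasure.variation_le_variationIn {u : EuclideanSpace ℝ (Fin n) → ℝ}
    {D : VectorMeasure (EuclideanSpace ℝ (Fin n)) (EuclideanSpace ℝ (Fin n))}
    (hD : IsGradientMeasure Ω u D) (hΩ : IsOpen Ω) (hu : LocallyIntegrableOn u Ω) :
    D.variation Ω ≤ variationIn Ω u := by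
  classical
  set D' := D.restrict Ω with hD'
  have hvar : D'.variation = D.variation.restrict Ω :=
    VectorMeasure.variation_restrict hΩ.measurableSet
  have hfin : IsFiniteMeasure D'.variation := by
    rw [hvar]; exact ⟨by simpa using hD.variation_lt_top⟩
  have hΩu : D.variation Ω = D'.variation Ω := by simp [hvar]
  rw [hΩu]
  refine le_of_forall_lt fun c hc => ?_
  obtain ⟨P, hPΩ, hPd, hPm, hcP⟩ := D'.exists_lt_sum_of_lt_variation hΩ.measurableSet hc
  -- the slack in `c < ∑ ‖D' p‖` is distributed over the members of the partition
  obtain ⟨δ, hδ, hcδ⟩ : ∃ δ : ℝ, 0 < δ ∧ c.toReal < ∑ p ∈ P, (‖D' p‖ - 2 * δ) := by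
    have h1 : c.toReal < ∑ p ∈ P, ‖D' p‖ := by
      have : ∑ p ∈ P, ‖D' p‖ₑ = ENNReal.ofReal (∑ p ∈ P, ‖D' p‖) := by
        rw [ENNReal.ofReal_sum_of_nonneg fun _ _ => norm_nonneg _]
        simp
      rw [this] at hcP
      exact (ENNReal.lt_ofReal_iff_toReal_lt hcP.ne_top).1 hcP
    refine ⟨(∑ p ∈ P, ‖D' p‖ - c.toReal) / (4 * (P.card + 1)), by
      have := sub_pos.2 h1; positivity, ?_⟩
    rw [Finset.sum_sub_distrib, Finset.sum_const, nsmul_eq_mul]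
    have hpos := sub_pos.2 h1
    have : (P.card : ℝ) * (2 * ((∑ p ∈ P, ‖D' p‖ - c.toReal) / (4 * (P.card + 1))))
        < ∑ p ∈ P, ‖D' p‖ - c.toReal := by
      rw [show (P.card : ℝ) * (2 * ((∑ p ∈ P, ‖D' p‖ - c.toReal) / (4 * (P.card + 1))))
        = (∑ p ∈ P, ‖D' p‖ - c.toReal) * (P.card / (2 * (P.card + 1))) by field_simp; ring]
      have h3 : (P.card : ℝ) / (2 * (P.card + 1)) < 1 := by
        rw [div_lt_one (by positivity)]
        have : (0 : ℝ) ≤ P.card := by positivity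
        linarith
      nlinarith
    linarith
  have hcpt : ∀ p ∈ P, ∃ K ⊆ p, IsCompact K ∧ D'.variation (p \ K) < ENNReal.ofReal δ :=
    fun p hp => (hPm p hp).exists_isCompact_sdiff_lt (measure_ne_top _ _) (by simpa using hδ)
  choose! K hKp hKc hKδ using hcpt
  have hKd : (P : Set (Set (EuclideanSpace ℝ (Fin n)))).PairwiseDisjoint
      fun p => nhdsSet (K p) := by
    intro p hp q hq hpq
    exact disjoint_nhdsSet_nhdsSet (hKc p hp).isClosed (hKc q hq).isClosed
      ((hPd hp hq hpq).mono (hKp p hp) (hKp q hq))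
  obtain ⟨V, hV, hVd⟩ := hKd.exists_mem_filter P.finite_toSet
  have hopen : ∀ p ∈ P, ∃ U ⊇ K p, IsOpen U ∧ U ⊆ V p ∩ Ω ∧
      D'.variation (U \ K p) < ENNReal.ofReal δ := by
    intro p hp
    obtain ⟨U, hKU, hUo, -, hU⟩ := (hKc p hp).measurableSet.exists_isOpen_sdiff_lt
      (μ := D'.variation) (measure_ne_top _ _) (ε := ENNReal.ofReal δ) (by simpa using hδ)
    refine ⟨U ∩ (interior (V p) ∩ Ω), subset_inter hKU (subset_inter
      (subset_interior_iff_mem_nhdsSet.2 (hV p)) ((hKp p hp).trans (hPΩ p hp))),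
      hUo.inter (isOpen_interior.inter hΩ), ?_, (measure_mono ?_).trans_lt hU⟩
    · exact inter_subset_right.trans (inter_subset_inter_left _ interior_subset)
    · exact sdiff_subset_sdiff_left inter_subset_left
  choose! U hKU hUo hUV hUδ using hopen
  have hcut := fun p hp => exists_cutoff_norm_integral_sub_le D' (hKc p hp) (hUo p hp) (hKU p hp)
  choose! φ hφU hφ01 hφD using hcut
  have hφΩ : ∀ p ∈ P, IsTestFunction Ω (φ p) := fun p hp =>
    (hφU p hp).mono ((hUV p hp).trans inter_subset_right)
  -- the test field: on the support of `φ p` it points against `D' p`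
  set v : Set (EuclideanSpace ℝ (Fin n)) → EuclideanSpace ℝ (Fin n) :=
    fun p => -(‖D' p‖⁻¹ • D' p) with hv
  have hv1 : ∀ p, ‖v p‖ ≤ 1 := by
    intro p
    simp only [hv, norm_neg, norm_smul, norm_inv, norm_norm]
    exact inv_mul_le_one
  have htest : ∀ p ∈ P, IsTestFunction Ω fun x => φ p x • v p := fun p hp =>
    (hφΩ p hp).clm_comp ((ContinuousLinearMap.id ℝ ℝ).smulRight (v p))
  set Φ := ∑ p ∈ P, fun x => φ p x • v p with hΦ
  have hΦt : IsTestFunction Ω Φ := IsTestFunction.finset_sum P htest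
  have hΦ1 : ∀ x, ‖Φ x‖ ≤ 1 := by
    intro x
    rw [hΦ, Finset.sum_apply]
    by_cases h : ∃ p ∈ P, x ∈ V p
    · obtain ⟨p, hp, hxp⟩ := h
      rw [Finset.sum_eq_single_of_mem p hp]
      · rw [norm_smul, Real.norm_of_nonneg (hφ01 p hp x).1]
        exact mul_le_one₀ (hφ01 p hp x).2 (norm_nonneg _) (hv1 p)
      · intro q hq hqp
        rw [(hφU q hq).eq_zero_of_notMem fun h => ?_, zero_smul]
        exact disjoint_left.1 (hVd hq hp hqp) (hUV q hq h).1 hxp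
    · push Not at h
      rw [Finset.sum_eq_zero, norm_zero]
      · exact zero_le_one
      · intro q hq
        rw [(hφU q hq).eq_zero_of_notMem fun h' => h q hq (hUV q hq h').1, zero_smul]
  have hint : ∫ x in Ω, u x * divergence Φ x = ∑ p ∈ P, - inner ℝ (v p) (∫ᵛ x, φ p x ∂•D') := by
    have hdiv (x) : u x * divergence Φ x = ∑ p ∈ P, u x * divergence (fun y => φ p y • v p) x := by
      rw [← Finset.mul_sum]
      congr 1
      rw [hΦ]
      have key : ∀ Q ⊆ P, divergence (∑ p ∈ Q, fun y => φ p y • v p) x =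
          ∑ p ∈ Q, divergence (fun y => φ p y • v p) x := by
        intro Q
        induction Q using Finset.induction_on with
        | empty => intro _; simp [divergence]
        | insert q Q hq ih =>
          intro hQ
          rw [Finset.sum_insert hq, Finset.sum_insert hq, divergence_add, ih]
          · exact (Finset.subset_insert q Q).trans hQ
          · exact (htest q (hQ (by simp))).differentiable
          · exact (IsTestFunction.finset_sum Q fun p hp => htest p
              (hQ (by simp [hp]))).differentiable
      exact key P subset_rfl
    simp_rw [hdiv]
    rw [integral_finsetSum _ fun p hp =>
      ((htest p hp).integrable_mul_divergence hu).integrableOn]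
    exact Finset.sum_congr rfl fun p hp => hD.integral_mul_divergence_smul_const hu (hφΩ p hp) _
  refine lt_of_lt_of_le ?_ (le_variationIn u hΦt hΦ1)
  rw [ENNReal.lt_ofReal_iff_toReal_lt hc.ne_top, hint]
  refine hcδ.trans_le (Finset.sum_le_sum fun p hp => ?_)
  have h1 : ‖D' (K p) - D' p‖ ≤ δ := by
    have : D' p - D' (K p) = D' (p \ K p) :=
      (D'.of_sdiff (hKc p hp).measurableSet (hPm p hp) (hKp p hp)).symm
    rw [← norm_neg, neg_sub, this]
    exact (D'.norm_measure_le_variation).trans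
      (ENNReal.toReal_le_of_le_ofReal hδ.le (hKδ p hp).le)
  have h2 : ‖(∫ᵛ x, φ p x ∂•D') - D' (K p)‖ ≤ δ :=
    (hφD p hp).trans (ENNReal.toReal_le_of_le_ofReal hδ.le (hUδ p hp).le)
  have h3 : - inner ℝ (v p) (D' p) = ‖D' p‖ := by
    simp only [hv, inner_neg_left, neg_neg, real_inner_smul_left, real_inner_self_eq_norm_sq]
    by_cases h0 : ‖D' p‖ = 0
    · simp [h0]
    · field_simp
  have h4 : |inner ℝ (v p) ((∫ᵛ x, φ p x ∂•D') - D' p)| ≤ 2 * δ := by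
    refine (abs_real_inner_le_norm _ _).trans ?_
    have h5 : ‖(∫ᵛ x, φ p x ∂•D') - D' p‖ ≤ 2 * δ := by
      rw [← sub_add_sub_cancel _ (D' (K p)), two_mul]
      exact (norm_add_le _ _).trans (add_le_add h2 h1)
    calc _ ≤ 1 * (2 * δ) := mul_le_mul (hv1 p) h5 (norm_nonneg _) zero_le_one
      _ = _ := one_mul _
  rw [inner_sub_right] at h4
  have := (abs_le.1 h4).2
  linarith

end

section

variable {n : ℕ} {Ω : Set (EuclideanSpace ℝ (Fin n))}

/-! ### The Riesz representation of bounded functionals on test fields -/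

/-- `L` restricts to a linear functional on `C_c^∞(Ω; F)` that is at most `M` on the unit ball of
the supremum norm. -/
structure IsBoundedFunctional {F : Type*} [NormedAddCommGroup F] [NormedSpace ℝ F]
    (Ω : Set (EuclideanSpace ℝ (Fin n))) (L : (EuclideanSpace ℝ (Fin n) → F) → ℝ) (M : ℝ) :
    Prop where
  map_add : ∀ Φ Ψ, IsTestFunction Ω Φ → IsTestFunction Ω Ψ → L (Φ + Ψ) = L Φ + L Ψ
  map_smul : ∀ (c : ℝ) Φ, IsTestFunction Ω Φ → L (c • Φ) = c * L Φ
  le_bound : ∀ Φ, IsTestFunction Ω Φ → (∀ x, ‖Φ x‖ ≤ 1) → L Φ ≤ M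

/-- The variation of `L` on `U`: the supremum of `L` over the unit ball of `C_c^∞(U ∩ Ω; F)`. -/
noncomputable def functionalVariation {F : Type*} [NormedAddCommGroup F] [NormedSpace ℝ F]
    (Ω : Set (EuclideanSpace ℝ (Fin n))) (L : (EuclideanSpace ℝ (Fin n) → F) → ℝ)
    (U : Set (EuclideanSpace ℝ (Fin n))) : ℝ≥0∞ :=
  ⨆ (Φ : EuclideanSpace ℝ (Fin n) → F) (_ : IsTestFunction (U ∩ Ω) Φ ∧ ∀ x, ‖Φ x‖ ≤ 1),
    ENNReal.ofReal (L Φ)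

/-- The variation of `L` on a compact set, as the infimum over open neighbourhoods. -/
noncomputable def compactVariation {F : Type*} [NormedAddCommGroup F] [NormedSpace ℝ F]
    (Ω : Set (EuclideanSpace ℝ (Fin n))) (L : (EuclideanSpace ℝ (Fin n) → F) → ℝ)
    (K : Set (EuclideanSpace ℝ (Fin n))) : ℝ≥0∞ :=
  ⨅ (U : Set (EuclideanSpace ℝ (Fin n))) (_ : IsOpen U ∧ K ⊆ U), functionalVariation Ω L U

namespace IsBoundedFunctional

section Content

variable {F : Type*} [NormedAddCommGroup F] [NormedSpace ℝ F]
  {L : (EuclideanSpace ℝ (Fin n) → F) → ℝ} {M : ℝ} {U V : Set (EuclideanSpace ℝ (Fin n))}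

lemma le_functionalVariation {Φ : EuclideanSpace ℝ (Fin n) → F}
    (hΦ : IsTestFunction (U ∩ Ω) Φ) (hΦ1 : ∀ x, ‖Φ x‖ ≤ 1) :
    ENNReal.ofReal (L Φ) ≤ functionalVariation Ω L U :=
  le_iSup₂_of_le Φ ⟨hΦ, hΦ1⟩ le_rfl

lemma functionalVariation_mono (h : U ⊆ V) :
    functionalVariation Ω L U ≤ functionalVariation Ω L V :=
  iSup₂_le fun Φ hΦ =>
    le_iSup₂_of_le Φ ⟨hΦ.1.mono (inter_subset_inter_left Ω h), hΦ.2⟩ le_rfl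

lemma functionalVariation_le (hL : IsBoundedFunctional Ω L M) (U : Set (EuclideanSpace ℝ (Fin n))) :
    functionalVariation Ω L U ≤ ENNReal.ofReal M :=
  iSup₂_le fun Φ hΦ =>
    ENNReal.ofReal_le_ofReal (hL.le_bound Φ (hΦ.1.mono inter_subset_right) hΦ.2)

/-- Subadditivity on open sets, by a smooth partition of unity. -/
lemma functionalVariation_union_le (hL : IsBoundedFunctional Ω L M) (hU : IsOpen U)
    (hV : IsOpen V) :
    functionalVariation Ω L (U ∪ V) ≤ functionalVariation Ω L U + functionalVariation Ω L V := by
  refine iSup₂_le fun Φ ⟨hΦ, hΦ1⟩ => ?_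
  obtain ⟨η, hη, hη1, hη01⟩ := exists_isTestFunction_eq_one_nhdsSet (U := U)
    (hΦ.hasCompactSupport.diff hV) hU fun x hx => by
      rcases (hΦ.tsupport_subset hx.1).1 with h | h
      · exact h
      · exact absurd h hx.2
  have h1 : IsTestFunction (U ∩ Ω) fun x => η x • Φ x := hΦ.smooth_smul hη.contDiff
    fun x hx => ⟨hη.tsupport_subset hx.1, (hΦ.tsupport_subset hx.2).2⟩
  have h2 : IsTestFunction (V ∩ Ω) fun x => (1 - η x) • Φ x := by
    refine hΦ.smooth_smul (contDiff_const.sub hη.contDiff)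
      fun x hx => ⟨?_, (hΦ.tsupport_subset hx.2).2⟩
    by_contra hxV
    refine notMem_tsupport_iff_eventuallyEq.2 ?_ hx.1
    filter_upwards [hη1.filter_mono (nhds_le_nhdsSet (s := tsupport Φ \ V) ⟨hx.2, hxV⟩)] with y hy
    simp [hy]
  have hsum : Φ = (fun x => η x • Φ x) + fun x => (1 - η x) • Φ x := by
    ext x; simp [← add_smul]
  have hadd := hL.map_add _ _ (h1.mono inter_subset_right) (h2.mono inter_subset_right)
  rw [← hsum] at hadd
  rw [hadd]
  refine ENNReal.ofReal_add_le.trans (add_le_add (le_functionalVariation h1 fun x => ?_)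
    (le_functionalVariation h2 fun x => ?_))
  · rw [norm_smul, Real.norm_of_nonneg (hη01 x).1]
    exact mul_le_one₀ (hη01 x).2 (norm_nonneg _) (hΦ1 x)
  · rw [norm_smul, Real.norm_of_nonneg (sub_nonneg.2 (hη01 x).2)]
    exact mul_le_one₀ (by linarith [(hη01 x).1]) (norm_nonneg _) (hΦ1 x)

lemma le_functionalVariation_union (hL : IsBoundedFunctional Ω L M) (hUV : Disjoint U V) :
    functionalVariation Ω L U + functionalVariation Ω L V ≤ functionalVariation Ω L (U ∪ V) := by
  have h0 : ∀ W : Set (EuclideanSpace ℝ (Fin n)), ∃ Φ : EuclideanSpace ℝ (Fin n) → F,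
      IsTestFunction (W ∩ Ω) Φ ∧ ∀ x, ‖Φ x‖ ≤ 1 := fun W => ⟨0, .zero, by simp⟩
  refine ENNReal.biSup_add_biSup_le' (h0 U) (h0 V) fun Φ ⟨hΦ, hΦ1⟩ Ψ ⟨hΨ, hΨ1⟩ => ?_
  rcases le_total (L Φ) 0 with hneg | hpos
  · rw [ENNReal.ofReal_of_nonpos hneg, zero_add]
    exact (le_functionalVariation hΨ hΨ1).trans (functionalVariation_mono subset_union_right)
  rcases le_total (L Ψ) 0 with hneg' | hpos'
  · rw [ENNReal.ofReal_of_nonpos hneg', add_zero]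
    exact (le_functionalVariation hΦ hΦ1).trans (functionalVariation_mono subset_union_left)
  rw [← ENNReal.ofReal_add hpos hpos',
    ← hL.map_add _ _ (hΦ.mono inter_subset_right) (hΨ.mono inter_subset_right)]
  refine le_iSup₂_of_le (Φ + Ψ) ⟨(hΦ.mono (inter_subset_inter_left Ω subset_union_left)).add
    (hΨ.mono (inter_subset_inter_left Ω subset_union_right)), fun x => ?_⟩ le_rfl
  by_cases hx : x ∈ U
  · have : Ψ x = 0 := hΨ.eq_zero_of_notMem fun h => disjoint_left.1 hUV hx h.1
    simpa [this] using hΦ1 x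
  · have : Φ x = 0 := hΦ.eq_zero_of_notMem fun h => hx h.1
    simpa [this] using hΨ1 x

lemma compactVariation_le (hL : IsBoundedFunctional Ω L M) (K : Set (EuclideanSpace ℝ (Fin n))) :
    compactVariation Ω L K ≤ ENNReal.ofReal M :=
  (iInf₂_le univ ⟨isOpen_univ, subset_univ K⟩).trans (hL.functionalVariation_le univ)

lemma compactVariation_ne_top (hL : IsBoundedFunctional Ω L M)
    (K : Set (EuclideanSpace ℝ (Fin n))) : compactVariation Ω L K ≠ ⊤ :=
  ((hL.compactVariation_le K).trans_lt ENNReal.ofReal_lt_top).ne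

lemma compactVariation_mono {K₁ K₂ : Set (EuclideanSpace ℝ (Fin n))} (h : K₁ ⊆ K₂) :
    compactVariation Ω L K₁ ≤ compactVariation Ω L K₂ :=
  le_iInf₂ fun U hU => iInf₂_le U ⟨hU.1, h.trans hU.2⟩

lemma compactVariation_union_le (hL : IsBoundedFunctional Ω L M)
    (K₁ K₂ : Set (EuclideanSpace ℝ (Fin n))) :
    compactVariation Ω L (K₁ ∪ K₂) ≤ compactVariation Ω L K₁ + compactVariation Ω L K₂ := by
  unfold compactVariation
  simp_rw [iInf_subtype']
  rw [ENNReal.iInf_add]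
  refine le_iInf fun U => ?_
  rw [ENNReal.add_iInf]
  refine le_iInf fun V => ?_
  exact (iInf_le _ ⟨U.1 ∪ V.1, U.2.1.union V.2.1, union_subset_union U.2.2 V.2.2⟩).trans
    (hL.functionalVariation_union_le U.2.1 V.2.1)

lemma le_compactVariation_union (hL : IsBoundedFunctional Ω L M)
    {K₁ K₂ : Set (EuclideanSpace ℝ (Fin n))} (h₁ : IsCompact K₁) (h₂ : IsCompact K₂)
    (h : Disjoint K₁ K₂) :
    compactVariation Ω L K₁ + compactVariation Ω L K₂ ≤ compactVariation Ω L (K₁ ∪ K₂) := by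
  refine le_iInf₂ fun U ⟨hU, hKU⟩ => ?_
  obtain ⟨V, W, hV, hW, hKV, hKW, hVW⟩ := SeparatedNhds.of_isCompact_isCompact h₁ h₂ h
  calc _ ≤ functionalVariation Ω L (U ∩ V) + functionalVariation Ω L (U ∩ W) :=
        add_le_add
          (iInf₂_le _ ⟨hU.inter hV, subset_inter (subset_union_left.trans hKU) hKV⟩)
          (iInf₂_le _ ⟨hU.inter hW, subset_inter (subset_union_right.trans hKU) hKW⟩)
    _ ≤ functionalVariation Ω L (U ∩ V ∪ U ∩ W) :=
        hL.le_functionalVariation_union (hVW.mono inter_subset_right inter_subset_right)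
    _ ≤ _ := functionalVariation_mono (union_subset inter_subset_left inter_subset_left)

/-- The content on compact sets whose measure is the total variation measure of `L`. -/
noncomputable def content (hL : IsBoundedFunctional Ω L M) :
    Content (EuclideanSpace ℝ (Fin n)) where
  toFun K := (compactVariation Ω L K).toNNReal
  mono' K₁ K₂ h := ENNReal.toNNReal_mono (hL.compactVariation_ne_top _) (compactVariation_mono h)
  sup_disjoint' K₁ K₂ h _ _ := by
    rw [← ENNReal.toNNReal_add (hL.compactVariation_ne_top _) (hL.compactVariation_ne_top _)]
    congr 1
    exact le_antisymm (hL.compactVariation_union_le _ _)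
      (hL.le_compactVariation_union K₁.isCompact K₂.isCompact h)
  sup_le' K₁ K₂ := by
    rw [← ENNReal.toNNReal_add (hL.compactVariation_ne_top _) (hL.compactVariation_ne_top _)]
    exact ENNReal.toNNReal_mono (ENNReal.add_ne_top.2
      ⟨hL.compactVariation_ne_top _, hL.compactVariation_ne_top _⟩)
      (hL.compactVariation_union_le _ _)

lemma content_apply (hL : IsBoundedFunctional Ω L M)
    (K : TopologicalSpace.Compacts (EuclideanSpace ℝ (Fin n))) :
    hL.content K = compactVariation Ω L K :=
  ENNReal.coe_toNNReal (hL.compactVariation_ne_top K)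

/-- The total variation measure of `L`. -/
noncomputable def measure (hL : IsBoundedFunctional Ω L M) : Measure (EuclideanSpace ℝ (Fin n)) :=
  hL.content.measure

instance (hL : IsBoundedFunctional Ω L M) : IsFiniteMeasure hL.measure := by
  refine ⟨?_⟩
  rw [measure, Content.measure_apply _ MeasurableSet.univ,
    Content.outerMeasure_of_isOpen _ _ isOpen_univ]
  refine (iSup₂_le fun K _ => ?_).trans_lt (ENNReal.ofReal_lt_top (r := M))
  rw [hL.content_apply]
  exact hL.compactVariation_le K

lemma functionalVariation_le_measure (hL : IsBoundedFunctional Ω L M) (hU : IsOpen U) :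
    functionalVariation Ω L U ≤ hL.measure U := by
  rw [measure, Content.measure_apply _ hU.measurableSet, Content.outerMeasure_of_isOpen _ _ hU]
  refine iSup₂_le fun Φ ⟨hΦ, hΦ1⟩ => ?_
  refine le_trans ?_ (Content.le_innerContent _ ⟨tsupport Φ, hΦ.hasCompactSupport⟩ _
    (hΦ.tsupport_subset.trans inter_subset_left))
  rw [hL.content_apply]
  exact le_iInf₂ fun V hV => le_functionalVariation ⟨hΦ.contDiff, hΦ.hasCompactSupport,
    subset_inter hV.2 (hΦ.tsupport_subset.trans inter_subset_right)⟩ hΦ1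

lemma le_mul_measure (hL : IsBoundedFunctional Ω L M) (hU : IsOpen U)
    {Φ : EuclideanSpace ℝ (Fin n) → F} (hΦ : IsTestFunction (U ∩ Ω) Φ) {m : ℝ} (hm : 0 < m)
    (hΦm : ∀ x, ‖Φ x‖ ≤ m) : L Φ ≤ m * hL.measure.real U := by
  have h1 : L (m⁻¹ • Φ) ≤ hL.measure.real U := by
    refine (ENNReal.ofReal_le_iff_le_toReal (measure_ne_top _ _)).1
      ((le_functionalVariation (hΦ.const_smul _) fun x => ?_).trans
        (hL.functionalVariation_le_measure hU))
    rw [Pi.smul_apply, norm_smul, norm_inv, Real.norm_of_nonneg hm.le]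
    exact inv_mul_le_one_of_le₀ (hΦm x) hm.le
  rw [hL.map_smul _ _ (hΦ.mono inter_subset_right)] at h1
  rwa [← inv_mul_le_iff₀ hm]

end Content

end IsBoundedFunctional

end

section

variable {n : ℕ} {Ω : Set (EuclideanSpace ℝ (Fin n))}

/-- A dyadic layer-cake bound: the layers above height `a` do not contribute, and those below it
form a geometric series. -/
lemma sum_dyadic_le (k : ℕ) {m a : ℝ} (hm : 0 < m) (ha : 0 ≤ a) :
    ∑ i ∈ Finset.range k, (if m / 2 ^ i / 4 < a then m / 2 ^ i else 0) ≤ 8 * a := by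
  suffices h : ∀ m : ℝ, 0 < m →
      ∑ i ∈ Finset.range k, (if m / 2 ^ i / 4 < a then m / 2 ^ i else 0) ≤ min (8 * a) (2 * m) from
    (h m hm).trans (min_le_left _ _)
  induction k with
  | zero => intro m hm; simp; constructor <;> positivity
  | succ k ih =>
    intro m hm
    have h2 (i : ℕ) : m / 2 ^ (i + 1) = m / 2 / 2 ^ i := by rw [pow_succ', div_div]
    rw [Finset.sum_range_succ']
    simp_rw [h2]
    have := le_min_iff.1 (ih (m / 2) (by positivity))
    simp only [pow_zero, div_one]
    refine le_min_iff.2 ?_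
    split_ifs <;> constructor <;> linarith [this.1, this.2]

/-- The test functions on `Ω` as a linear subspace of all functions. -/
def testFunctions (Ω : Set (EuclideanSpace ℝ (Fin n))) (F : Type*)
    [NormedAddCommGroup F] [NormedSpace ℝ F] : Submodule ℝ (EuclideanSpace ℝ (Fin n) → F) where
  carrier := {Φ | IsTestFunction Ω Φ}
  add_mem' := IsTestFunction.add
  zero_mem' := .zero
  smul_mem' c _ h := h.const_smul c

namespace IsBoundedFunctional

section

variable {F : Type*} [NormedAddCommGroup F] [InnerProductSpace ℝ F]
  {L : (EuclideanSpace ℝ (Fin n) → F) → ℝ} {M : ℝ}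

lemma le_mul_bound (hL : IsBoundedFunctional Ω L M)
    {Φ : EuclideanSpace ℝ (Fin n) → F} (hΦ : IsTestFunction Ω Φ) {m : ℝ} (hm : 0 < m)
    (hΦm : ∀ x, ‖Φ x‖ ≤ m) : L Φ ≤ m * M := by
  have h1 := hL.le_bound (m⁻¹ • Φ) (hΦ.const_smul _) fun x => by
    rw [Pi.smul_apply, norm_smul, norm_inv, Real.norm_of_nonneg hm.le]
    exact inv_mul_le_one_of_le₀ (hΦm x) hm.le
  rw [hL.map_smul _ _ hΦ] at h1
  rwa [← inv_mul_le_iff₀ hm]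

/-- Peeling off dyadic layers of `‖Φ‖`: a smooth function of `‖Φ‖²` splits `Φ` into a part
supported in `{m / 4 < ‖Φ‖}` and a part bounded by `m / 2`. -/
lemma le_sum_dyadic (hL : IsBoundedFunctional Ω L M) (k : ℕ) {m : ℝ} (hm : 0 < m)
    {Φ : EuclideanSpace ℝ (Fin n) → F} (hΦ : IsTestFunction Ω Φ) (hΦm : ∀ x, ‖Φ x‖ ≤ m) :
    L Φ ≤ ∑ i ∈ Finset.range k, m / 2 ^ i * hL.measure.real {x | m / 2 ^ i / 4 < ‖Φ x‖}
      + m / 2 ^ k * M := by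
  induction k generalizing m Φ with
  | zero => simpa using hL.le_mul_bound hΦ hm hΦm
  | succ k ih =>
    -- `η = 0` where `‖Φ‖² ≤ m² / 8` and `η = 1` where `‖Φ‖ ≥ m / 2`; since `m / 4 < m / √8`, the
    -- closed support of `η` lies in the open set `{m / 4 < ‖Φ‖}`
    set η : EuclideanSpace ℝ (Fin n) → ℝ :=
      fun x => Real.smoothTransition (8 * (‖Φ x‖ ^ 2 / m ^ 2) - 1) with hη
    have hηs : ContDiff ℝ ∞ η := Real.smoothTransition.contDiff.comp
      (((contDiff_const.mul ((hΦ.contDiff.norm_sq ℝ).div_const _))).sub contDiff_const)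
    have hη0 : ∀ x, 0 ≤ η x := fun x => Real.smoothTransition.nonneg _
    have hη1 : ∀ x, η x ≤ 1 := fun x => Real.smoothTransition.le_one _
    have hopen : IsOpen {x | m / 4 < ‖Φ x‖} := isOpen_lt continuous_const hΦ.continuous.norm
    have h1 : IsTestFunction ({x | m / 4 < ‖Φ x‖} ∩ Ω) fun x => η x • Φ x := by
      refine hΦ.smooth_smul hηs fun x hx => ⟨?_, hΦ.tsupport_subset hx.2⟩
      have hcl : IsClosed {x | m ^ 2 / 8 ≤ ‖Φ x‖ ^ 2} :=
        isClosed_le continuous_const (hΦ.continuous.norm.pow 2)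
      have hx' : x ∈ {x | m ^ 2 / 8 ≤ ‖Φ x‖ ^ 2} := by
        refine closure_minimal (fun y hy => ?_) hcl hx.1
        by_contra hlt
        simp only [mem_ofPred_eq, not_le] at hlt
        refine hy (Real.smoothTransition.zero_of_nonpos ?_)
        have : ‖Φ y‖ ^ 2 / m ^ 2 < 1 / 8 := by
          rw [div_lt_iff₀ (by positivity)]; linarith
        linarith
      simp only [mem_ofPred_eq] at hx' ⊢
      refine lt_of_pow_lt_pow_left₀ 2 (norm_nonneg _) (lt_of_lt_of_le ?_ hx')
      rw [div_pow]
      have : 0 < m ^ 2 := by positivity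
      linarith
    have h2 : IsTestFunction Ω fun x => (1 - η x) • Φ x :=
      hΦ.smooth_smul (contDiff_const.sub hηs) (inter_subset_right.trans hΦ.tsupport_subset)
    have hn2 : ∀ x, ‖(1 - η x) • Φ x‖ ≤ ‖Φ x‖ := fun x => by
      rw [norm_smul, Real.norm_of_nonneg (sub_nonneg.2 (hη1 x))]
      exact mul_le_of_le_one_left (norm_nonneg _) (by linarith [hη0 x])
    have hn2' : ∀ x, ‖(1 - η x) • Φ x‖ ≤ m / 2 := fun x => by
      rcases le_total ‖Φ x‖ (m / 2) with hx | hx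
      · exact (hn2 x).trans hx
      · have : η x = 1 := by
          refine Real.smoothTransition.one_of_one_le ?_
          have : 1 / 4 ≤ ‖Φ x‖ ^ 2 / m ^ 2 := by
            rw [le_div_iff₀ (by positivity)]
            have := pow_le_pow_left₀ (by positivity) hx 2
            linarith [div_pow m 2 2]
          linarith
        simp only [this, sub_self, zero_smul, norm_zero]
        positivity
    have hsum : Φ = (fun x => η x • Φ x) + fun x => (1 - η x) • Φ x := by
      ext x; simp [← add_smul]
    have hadd := hL.map_add _ _ (h1.mono inter_subset_right) h2
    rw [← hsum] at hadd
    have hb1 := hL.le_mul_measure hopen h1 hm fun x => by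
      rw [norm_smul, Real.norm_of_nonneg (hη0 x)]
      exact (mul_le_of_le_one_left (norm_nonneg _) (hη1 x)).trans (hΦm x)
    have hb2 := ih (m := m / 2) (by positivity) h2 hn2'
    have hpow (i : ℕ) : m / 2 ^ (i + 1) = m / 2 / 2 ^ i := by rw [pow_succ', div_div]
    rw [Finset.sum_range_succ']
    simp_rw [hpow]
    have hmono : ∑ i ∈ Finset.range k,
          m / 2 / 2 ^ i * hL.measure.real {x | m / 2 / 2 ^ i / 4 < ‖(1 - η x) • Φ x‖} ≤
        ∑ i ∈ Finset.range k, m / 2 / 2 ^ i * hL.measure.real {x | m / 2 / 2 ^ i / 4 < ‖Φ x‖} := by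
      refine Finset.sum_le_sum fun i _ => ?_
      gcongr
      · exact measure_ne_top _ _
      · exact hn2 _
    simp only [pow_zero, div_one]
    linarith

/-- `L` is bounded in `L¹` of its variation measure. The constant `8` is not sharp. -/
theorem le_integral_norm (hL : IsBoundedFunctional Ω L M)
    {Φ : EuclideanSpace ℝ (Fin n) → F} (hΦ : IsTestFunction Ω Φ) :
    L Φ ≤ 8 * ∫ x, ‖Φ x‖ ∂hL.measure := by
  obtain ⟨C, hC⟩ := hΦ.continuous.bounded_above_of_compact_support hΦ.hasCompactSupport
  set m := max C 1
  have hm : 0 < m := lt_of_lt_of_le one_pos (le_max_right _ _)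
  have hΦi : Integrable (fun x => ‖Φ x‖) hL.measure :=
    (hΦ.continuous.integrable_of_hasCompactSupport hΦ.hasCompactSupport).norm
  have hk (k : ℕ) : L Φ ≤ 8 * (∫ x, ‖Φ x‖ ∂hL.measure) + m / 2 ^ k * M := by
    refine (hL.le_sum_dyadic k hm hΦ fun x => (hC x).trans (le_max_left _ _)).trans ?_
    gcongr
    have hmeas (i : ℕ) : MeasurableSet {x | m / 2 ^ i / 4 < ‖Φ x‖} :=
      (isOpen_lt continuous_const hΦ.continuous.norm).measurableSet
    have hset (i : ℕ) : m / 2 ^ i * hL.measure.real {x | m / 2 ^ i / 4 < ‖Φ x‖} =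
        ∫ x, (if m / 2 ^ i / 4 < ‖Φ x‖ then m / 2 ^ i else 0) ∂hL.measure := by
      have : (fun x => if m / 2 ^ i / 4 < ‖Φ x‖ then m / 2 ^ i else 0) =
          {x | m / 2 ^ i / 4 < ‖Φ x‖}.indicator fun _ => m / 2 ^ i := by
        ext x; simp [indicator_apply]
      rw [this, integral_indicator (hmeas i)]
      simp [mul_comm]
    have hint (i : ℕ) : Integrable
        (fun x => if m / 2 ^ i / 4 < ‖Φ x‖ then m / 2 ^ i else 0) hL.measure := by
      have : (fun x => if m / 2 ^ i / 4 < ‖Φ x‖ then m / 2 ^ i else 0) =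
          {x | m / 2 ^ i / 4 < ‖Φ x‖}.indicator fun _ => m / 2 ^ i := by
        ext x; simp [indicator_apply]
      rw [this]
      exact (integrable_const _).indicator (hmeas i)
    simp_rw [hset]
    rw [← integral_finsetSum _ fun i _ => hint i, ← integral_const_mul]
    exact integral_mono (integrable_finsetSum _ fun i _ => hint i) (hΦi.const_mul 8)
      fun x => sum_dyadic_le k hm (norm_nonneg _)
  have hlim : Filter.Tendsto (fun k : ℕ => 8 * (∫ x, ‖Φ x‖ ∂hL.measure) + m / 2 ^ k * M)
      Filter.atTop (nhds (8 * (∫ x, ‖Φ x‖ ∂hL.measure) + 0 * M)) :=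
    (((tendsto_const_nhds.div_atTop
      (tendsto_pow_atTop_atTop_of_one_lt one_lt_two)).mul_const M).const_add _)
  simpa using ge_of_tendsto' hlim hk

/-- **Riesz representation**: a bounded functional on test fields is integration against a
vector field, with respect to a finite measure. The functional is bounded in `L¹(μ)`, hence in
`L²(μ)`, where the Fréchet-Riesz theorem applies. -/
theorem exists_integrable_forall_eq_integral_inner [CompleteSpace F]
    (hL : IsBoundedFunctional Ω L M) :
    ∃ (μ : Measure (EuclideanSpace ℝ (Fin n))) (g : EuclideanSpace ℝ (Fin n) → F),
      IsFiniteMeasure μ ∧ Integrable g μ ∧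
        ∀ Φ, IsTestFunction Ω Φ → L Φ = ∫ x, inner ℝ (g x) (Φ x) ∂μ := by
  set μ := hL.measure
  have hmem (Φ : testFunctions Ω F) : MemLp Φ.1 2 μ :=
    (show IsTestFunction Ω Φ.1 from Φ.2).continuous.memLp_of_hasCompactSupport Φ.2.hasCompactSupport
  let j : testFunctions Ω F →ₗ[ℝ] Lp F 2 μ :=
    { toFun Φ := (hmem Φ).toLp Φ.1
      map_add' _ _ := rfl
      map_smul' _ _ := rfl }
  let ℓ : testFunctions Ω F →ₗ[ℝ] ℝ :=
    { toFun Φ := L Φ.1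
      map_add' Φ Ψ := hL.map_add _ _ Φ.2 Ψ.2
      map_smul' c Φ := hL.map_smul c _ Φ.2 }
  obtain ⟨C, hC⟩ : ∃ C : ℝ, ∀ Φ, |ℓ Φ| ≤ C * ‖j Φ‖ := by
    refine ⟨8 * (μ univ ^ (1 / 2 : ℝ)).toReal, fun Φ => ?_⟩
    have hI : ∫ x, ‖Φ.1 x‖ ∂μ ≤ (μ univ ^ (1 / 2 : ℝ)).toReal * ‖j Φ‖ := by
      have h := eLpNorm_le_eLpNorm_mul_rpow_measure_univ (μ := μ) (p := 1) (q := 2) (by norm_num)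
        (hmem Φ).1
      have hexp : (1 / (1 : ℝ≥0∞).toReal - 1 / (2 : ℝ≥0∞).toReal) = 1 / 2 := by norm_num
      rw [eLpNorm_one_eq_lintegral_enorm, hexp] at h
      have hfin : μ univ ^ (1 / 2 : ℝ) ≠ ⊤ :=
        ENNReal.rpow_ne_top_of_nonneg (by norm_num) (measure_ne_top _ _)
      rw [integral_norm_eq_lintegral_enorm (hmem Φ).1, mul_comm,
        show ‖j Φ‖ = (eLpNorm Φ.1 2 μ).toReal from Lp.norm_toLp _ (hmem Φ), ← ENNReal.toReal_mul]
      exact ENNReal.toReal_mono (ENNReal.mul_ne_top (hmem Φ).2.ne hfin) h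
    have hneg : -L Φ.1 ≤ 8 * ∫ x, ‖Φ.1 x‖ ∂μ := by
      have h := hL.le_integral_norm (Φ := (-1 : ℝ) • Φ.1) (IsTestFunction.const_smul Φ.2 _)
      rw [hL.map_smul _ _ Φ.2] at h
      simpa using h
    have hpos : L Φ.1 ≤ 8 * ∫ x, ‖Φ.1 x‖ ∂μ := hL.le_integral_norm Φ.2
    rw [mul_assoc]
    refine abs_le.2 ⟨?_, ?_⟩
    · change _ ≤ L Φ.1; linarith
    · change L Φ.1 ≤ _; linarith
  -- `ℓ` vanishes on the kernel of `j`, so that it factors through the image of `j` in `L²(μ)`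
  obtain ⟨ℓ', hℓ'⟩ : ∃ ℓ' : Module.Dual ℝ (Lp F 2 μ), j.dualMap ℓ' = ℓ := by
    rw [← LinearMap.mem_range, LinearMap.range_dualMap_eq_dualAnnihilator_ker,
      Submodule.mem_dualAnnihilator]
    intro Φ hΦ
    have := hC Φ
    rw [LinearMap.mem_ker.1 hΦ, norm_zero, mul_zero] at this
    exact abs_nonpos_iff.1 this
  have hℓj (Φ : testFunctions Ω F) : ℓ' (j Φ) = L Φ.1 := LinearMap.congr_fun hℓ' Φ
  obtain ⟨ℓc, hℓc, -⟩ := exists_extension_norm_eq (LinearMap.range j)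
    ((ℓ'.domRestrict (LinearMap.range j)).mkContinuous C (by
      rintro ⟨_, Φ, rfl⟩
      exact (congrArg norm (hℓj Φ)).trans_le (hC Φ)))
  obtain ⟨g, hg⟩ := (InnerProductSpace.toDual ℝ (Lp F 2 μ)).surjective ℓc
  refine ⟨μ, g, inferInstance, (Lp.memLp g).integrable (by norm_num), fun Φ hΦ => ?_⟩
  have h1 : L Φ = ℓc (j ⟨Φ, hΦ⟩) := by
    rw [hℓc ⟨j ⟨Φ, hΦ⟩, LinearMap.mem_range_self j _⟩]
    exact (hℓj ⟨Φ, hΦ⟩).symm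
  rw [h1, ← hg, InnerProductSpace.toDual_apply_apply, L2.inner_def]
  refine integral_congr_ae ?_
  filter_upwards [(hmem ⟨Φ, hΦ⟩).coeFn_toLp] with x hx
  exact congrArg _ hx

end

end IsBoundedFunctional

/-! ### Integrals against a vector measure with density -/

/-- Integrating a bounded function against the vector measure `g • μ` amounts to integrating its
product with `g` against `μ`. -/
lemma integral_lsmul_withDensityᵥ {X F : Type*} [MeasurableSpace X] [NormedAddCommGroup F]
    [NormedSpace ℝ F] [CompleteSpace F] {μ : Measure X} {g : X → F} (hg : Integrable g μ)
    {φ : X → ℝ} (hφ : StronglyMeasurable φ) {C : ℝ} (hφC : ∀ x, ‖φ x‖ ≤ C) :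
    ∫ᵛ x, φ x ∂•(μ.withDensityᵥ g) = ∫ x, φ x • g x ∂μ := by
  set D := μ.withDensityᵥ g with hD
  have hvar : D.variation = μ.withDensity fun x => ‖g x‖ₑ := Measure.variation_withDensityᵥ hg
  have hfin : IsFiniteMeasure D.variation := by
    rw [hvar]
    exact isFiniteMeasure_withDensity hg.2.ne
  have hC : 0 ≤ C ∨ IsEmpty X := by
    rcases isEmpty_or_nonempty X with h | ⟨⟨x⟩⟩
    · exact .inr h
    · exact .inl ((norm_nonneg _).trans (hφC x))
  rcases hC with hC | hX
  swap
  · simp [Measure.eq_zero_of_isEmpty μ, VectorMeasure.integral_of_isEmpty]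
  have hsimple (s : SimpleFunc X ℝ) : ∫ᵛ x, s x ∂•D = ∫ x, s x • g x ∂μ := by
    have hsb (s : SimpleFunc X ℝ) : Integrable (fun x => s x • g x) μ := by
      obtain ⟨B, hB⟩ := s.exists_forall_norm_le
      exact hg.bdd_smul B s.measurable.aestronglyMeasurable (.of_forall hB)
    induction s using SimpleFunc.induction with
    | @const c s hs =>
      have h1 (x) : (SimpleFunc.piecewise _ hs (.const X c) (.const X 0) : SimpleFunc X ℝ) x
          = indicator s (fun _ => c) x := by
        rw [SimpleFunc.coe_piecewise]; simp [indicator, piecewise]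
      simp_rw [h1]
      rw [VectorMeasure.integral_indicator hs, VectorMeasure.integral_const]
      have h2 : (fun x => s.indicator (fun _ => c) x • g x) = s.indicator fun x => c • g x := by
        ext x
        by_cases hx : x ∈ s <;> simp [hx]
      rw [h2, integral_indicator hs, integral_smul]
      simp [hD, withDensityᵥ_apply hg hs]
    | add _ hs ht =>
      simp only [SimpleFunc.coe_add, Pi.add_apply, add_smul]
      rw [VectorMeasure.integral_fun_add (SimpleFunc.integrable_of_isFiniteMeasure _)
        (SimpleFunc.integrable_of_isFiniteMeasure _), hs, ht, integral_add (hsb _) (hsb _)]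
  have h1 : Filter.Tendsto (fun k => ∫ᵛ x, hφ.approxBounded C k x ∂•D) Filter.atTop
      (nhds (∫ᵛ x, φ x ∂•D)) :=
    VectorMeasure.tendsto_integral_of_dominated_convergence (fun _ => C)
      (fun k => (hφ.approxBounded C k).measurable.aestronglyMeasurable) (integrable_const _)
      (fun k => .of_forall fun x => hφ.norm_approxBounded_le hC k x)
      (.of_forall fun x => hφ.tendsto_approxBounded_of_norm_le (hφC x))
  have h2 : Filter.Tendsto (fun k => ∫ x, hφ.approxBounded C k x • g x ∂μ) Filter.atTop
      (nhds (∫ x, φ x • g x ∂μ)) := by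
    refine tendsto_integral_of_dominated_convergence (fun x => C * ‖g x‖)
      (fun k => (hφ.approxBounded C k).measurable.aestronglyMeasurable.smul hg.1)
      (hg.norm.const_mul C) (fun k => .of_forall fun x => ?_) (.of_forall fun x =>
        (hφ.tendsto_approxBounded_of_norm_le (hφC x)).smul_const _)
    rw [norm_smul]
    gcongr
    exact hφ.norm_approxBounded_le hC k x
  simp_rw [hsimple] at h1
  exact tendsto_nhds_unique h1 h2

/-- A locally integrable function of finite variation has a gradient measure, and the total
variation of that measure is the variation of the function. -/
theorem exists_isGradientMeasure (hΩ : IsOpen Ω) {u : EuclideanSpace ℝ (Fin n) → ℝ}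
    (hu : LocallyIntegrableOn u Ω) (hfin : variationIn Ω u < ⊤) :
    ∃ D : VectorMeasure (EuclideanSpace ℝ (Fin n)) (EuclideanSpace ℝ (Fin n)),
      IsGradientMeasure Ω u D ∧ D.variation Ω = variationIn Ω u := by
  -- the density `g` of `Φ ↦ ∫ u div Φ` is the density of the gradient up to the sign
  have hL : IsBoundedFunctional Ω (fun Φ => ∫ x in Ω, u x * divergence Φ x)
      (variationIn Ω u).toReal :=
    { map_add Φ Ψ hΦ hΨ := by
        simp_rw [divergence_add hΦ.differentiable hΨ.differentiable, mul_add]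
        exact integral_add (hΦ.integrable_mul_divergence hu).integrableOn
          (hΨ.integrable_mul_divergence hu).integrableOn
      map_smul c Φ hΦ := by
        simp_rw [divergence_const_smul, mul_left_comm _ c]
        exact integral_const_mul _ _
      le_bound Φ hΦ h1 :=
        (ENNReal.ofReal_le_iff_le_toReal hfin.ne).1 (le_variationIn u hΦ h1) }
  obtain ⟨μ, g, hμ, hg, hLg⟩ := hL.exists_integrable_forall_eq_integral_inner
  have hvar : (μ.withDensityᵥ (-g)).variation = μ.withDensity fun x => ‖g x‖ₑ := by
    rw [Measure.variation_withDensityᵥ hg.neg]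
    simp
  have hgrad : IsGradientMeasure Ω u (μ.withDensityᵥ (-g)) :=
    { variation_lt_top := by
        rw [hvar]
        have := isFiniteMeasure_withDensity (μ := μ) hg.2.ne
        exact measure_lt_top _ _
      integral_eq φ hφ i := by
        obtain ⟨C, hC⟩ := hφ.continuous.bounded_above_of_compact_support hφ.hasCompactSupport
        have hind : Ω.indicator φ = φ :=
          indicator_eq_self.2 ((subset_tsupport φ).trans hφ.tsupport_subset)
        rw [← VectorMeasure.integral_indicator hΩ.measurableSet, hind,
          integral_lsmul_withDensityᵥ hg.neg hφ.continuous.stronglyMeasurable hC]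
        have hint : Integrable (fun x => φ x • (-g) x) μ :=
          hg.neg.bdd_smul C hφ.continuous.aestronglyMeasurable (.of_forall hC)
        have htest := hLg (fun x => φ x • EuclideanSpace.single i 1)
          (hφ.clm_comp ((ContinuousLinearMap.id ℝ ℝ).smulRight (EuclideanSpace.single i 1)))
        have hdiv (x : EuclideanSpace ℝ (Fin n)) :
            divergence (fun x => φ x • EuclideanSpace.single i (1 : ℝ)) x =
              fderiv ℝ φ x (EuclideanSpace.single i 1) := by
          simp [divergence_smul_const hφ.differentiable]
        simp_rw [hdiv] at htest
        rw [htest, ← integral_neg]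
        have hproj := (EuclideanSpace.proj i : EuclideanSpace ℝ (Fin n) →L[ℝ] ℝ).integral_comp_comm
          hint
        refine hproj.symm.trans (integral_congr_ae (.of_forall fun x => ?_))
        simp [PiLp.inner_apply] }
  refine ⟨_, hgrad, le_antisymm (hgrad.variation_le_variationIn hΩ hu) ?_⟩
  refine iSup₂_le fun Φ ⟨hΦ, hΦ1⟩ => ?_
  rw [hLg Φ hΦ, hvar, withDensity_apply _ hΩ.measurableSet,
    ← ofReal_integral_norm_eq_lintegral_enorm hg.integrableOn]
  refine ENNReal.ofReal_le_ofReal ?_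
  rw [← setIntegral_eq_integral_of_forall_compl_eq_zero (s := Ω)
    fun x hx => by rw [hΦ.eq_zero_of_notMem hx, inner_zero_right]]
  refine (Real.le_norm_self _).trans (norm_integral_le_of_norm_le hg.norm.integrableOn
    (.of_forall fun x => (norm_inner_le_norm _ _).trans ?_))
  exact mul_le_of_le_one_right (norm_nonneg _) (hΦ1 x)

end

section

variable {n : ℕ} {Ω : Set (EuclideanSpace ℝ (Fin n))}

/-! ### The layer-cake formula and the lower bound for the integral of the perimeters -/

/-- The kernel of the layer-cake formula `a = ∫ layerCake a t dt` for real numbers `a` of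
arbitrary sign. -/
noncomputable def layerCake (a t : ℝ) : ℝ := (if t < a then 1 else 0) - (if t < 0 then 1 else 0)

lemma layerCake_eq (a t : ℝ) : layerCake a t =
    (Ico 0 a).indicator (fun _ => 1) t - (Ico a 0).indicator (fun _ => 1) t := by
  simp only [layerCake, indicator_apply, mem_Ico]
  grind

lemma norm_layerCake (a t : ℝ) : ‖layerCake a t‖ =
    (Ico 0 a).indicator (fun _ => 1) t + (Ico a 0).indicator (fun _ => 1) t := by
  simp only [layerCake, indicator_apply, mem_Ico, Real.norm_eq_abs]
  grind

lemma integrable_indicator_Ico (a b : ℝ) :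
    Integrable ((Ico a b).indicator fun _ => (1 : ℝ)) :=
  (integrable_indicator_iff measurableSet_Ico).2 (integrableOn_const (by simp))

lemma integral_indicator_Ico (a b : ℝ) :
    ∫ t, (Ico a b).indicator (fun _ => (1 : ℝ)) t = max (b - a) 0 := by
  rw [integral_indicator measurableSet_Ico]
  simp [Real.volume_real_Ico]

lemma integrable_layerCake (a : ℝ) : Integrable (layerCake a) := by
  rw [funext (layerCake_eq a)]
  exact (integrable_indicator_Ico 0 a).sub (integrable_indicator_Ico a 0)

lemma integral_layerCake (a : ℝ) : ∫ t, layerCake a t = a := by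
  simp_rw [layerCake_eq]
  rw [integral_sub (integrable_indicator_Ico 0 a) (integrable_indicator_Ico a 0),
    integral_indicator_Ico, integral_indicator_Ico]
  grind

lemma integral_norm_layerCake (a : ℝ) : ∫ t, ‖layerCake a t‖ = |a| := by
  simp_rw [norm_layerCake]
  rw [integral_add (integrable_indicator_Ico 0 a) (integrable_indicator_Ico a 0),
    integral_indicator_Ico, integral_indicator_Ico]
  grind

lemma measurable_layerCake : Measurable (Function.uncurry layerCake) :=
  (Measurable.ite (measurableSet_lt measurable_snd measurable_fst) measurable_const
    measurable_const).sub
    (Measurable.ite (measurableSet_lt measurable_snd measurable_const) measurable_const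
      measurable_const)

lemma measurableSet_superlevel (hΩ : IsOpen Ω) {f : EuclideanSpace ℝ (Fin n) → ℝ}
    (hf : Measurable f) (t : ℝ) : MeasurableSet (superlevel Ω f t) :=
  hΩ.measurableSet.inter (measurableSet_lt measurable_const hf)

lemma locallyIntegrableOn_indicator_superlevel (hΩ : IsOpen Ω)
    {f : EuclideanSpace ℝ (Fin n) → ℝ} (hf : Measurable f) (t : ℝ) :
    LocallyIntegrableOn ((superlevel Ω f t).indicator fun _ => (1 : ℝ)) Ω :=
  LocallyIntegrable.locallyIntegrableOn
    ((locallyIntegrable_const 1).indicator (measurableSet_superlevel hΩ hf t)) Ω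

variable {f : EuclideanSpace ℝ (Fin n) → ℝ}
  {Φ : EuclideanSpace ℝ (Fin n) → EuclideanSpace ℝ (Fin n)}

lemma IsTestFunction.indicator_superlevel_mul_divergence (hΦ : IsTestFunction Ω Φ) (t : ℝ)
    (x : EuclideanSpace ℝ (Fin n)) :
    (superlevel Ω f t).indicator (fun _ => 1) x * divergence Φ x =
      (if t < f x then 1 else 0) * divergence Φ x := by
  by_cases hx : x ∈ Ω
  · have hiff : x ∈ superlevel Ω f t ↔ t < f x := and_iff_right hx
    by_cases h : t < f x
    · rw [indicator_of_mem (hiff.2 h), if_pos h]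
    · rw [indicator_of_notMem (fun h' => h (hiff.1 h')), if_neg h]
  · rw [divergence_eq_zero_of_notMem_tsupport fun h => hx (hΦ.tsupport_subset h), mul_zero,
      mul_zero]

/-- The pairing of `f` with `div Φ` is the integral over all levels of the pairing of the
superlevel sets with `div Φ`. -/
lemma IsTestFunction.integral_mul_divergence_eq_integral_superlevel (hΦ : IsTestFunction Ω Φ)
    (hf : Measurable f) (hfi : Integrable f) :
    Integrable (fun t => ∫ x, (superlevel Ω f t).indicator (fun _ => 1) x * divergence Φ x) ∧
    ∫ x, f x * divergence Φ x =
      ∫ t, ∫ x, (superlevel Ω f t).indicator (fun _ => 1) x * divergence Φ x := by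
  have hint1 (t : ℝ) : Integrable fun x => (if t < f x then (1 : ℝ) else 0) * divergence Φ x := by
    refine hΦ.integrable_divergence.bdd_mul (c := 1) ?_ (.of_forall fun x => ?_)
    · exact (Measurable.ite (measurableSet_lt measurable_const hf) measurable_const
        measurable_const).aestronglyMeasurable
    · split_ifs <;> simp
  -- subtracting the constant `1` on negative levels does not change the pairing
  have hinner (t : ℝ) : ∫ x, layerCake (f x) t * divergence Φ x =
      ∫ x, (superlevel Ω f t).indicator (fun _ => 1) x * divergence Φ x := by
    simp_rw [hΦ.indicator_superlevel_mul_divergence, layerCake, sub_mul]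
    rw [integral_sub (hint1 t) (hΦ.integrable_divergence.const_mul _), integral_const_mul,
      hΦ.integral_divergence_eq_zero, mul_zero, sub_zero]
  have hmeas : AEStronglyMeasurable
      (Function.uncurry fun (x : EuclideanSpace ℝ (Fin n)) (t : ℝ) =>
        layerCake (f x) t * divergence Φ x) (volume.prod volume) := by
    refine Measurable.aestronglyMeasurable (Measurable.mul ?_ ?_)
    · exact measurable_layerCake.comp ((hf.comp measurable_fst).prodMk measurable_snd)
    · exact hΦ.continuous_divergence.measurable.comp measurable_fst
  have hint : Integrable (Function.uncurry fun (x : EuclideanSpace ℝ (Fin n)) (t : ℝ) =>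
      layerCake (f x) t * divergence Φ x) (volume.prod volume) := by
    refine (integrable_prod_iff hmeas).2 ⟨.of_forall fun x =>
      (integrable_layerCake (f x)).mul_const (divergence Φ x), ?_⟩
    simp only [Function.uncurry_apply_pair, norm_mul, integral_mul_const, integral_norm_layerCake]
    obtain ⟨C, hC⟩ := hΦ.continuous_divergence.bounded_above_of_compact_support
      hΦ.hasCompactSupport_divergence
    exact hfi.abs.mul_bdd (c := C) hΦ.continuous_divergence.norm.aestronglyMeasurable
      (.of_forall fun x => by simpa using hC x)
  have hswap := integral_integral_swap hint
  simp_rw [integral_mul_const, integral_layerCake, hinner] at hswap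
  refine ⟨?_, hswap⟩
  have := hint.integral_prod_right
  simpa only [Function.uncurry_apply_pair, hinner] using this

/-- The variation of `f` is at most the integral of the perimeters of its superlevel sets. -/
theorem variationIn_le_lintegral_perimeter (hf : Measurable f) (hfi : Integrable f) :
    variationIn Ω f ≤ ∫⁻ t : ℝ, perimeter (superlevel Ω f t) Ω := by
  refine iSup₂_le fun Φ ⟨hΦ, hΦ1⟩ => ?_
  obtain ⟨hint, heq⟩ := hΦ.integral_mul_divergence_eq_integral_superlevel hf hfi
  rw [hΦ.setIntegral_mul_divergence, heq]
  refine (ENNReal.ofReal_le_ofReal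
    (integral_mono hint hint.pos_part fun t => le_max_left _ _)).trans ?_
  rw [ofReal_integral_eq_lintegral_ofReal hint.pos_part (.of_forall fun t => le_max_right _ _)]
  refine lintegral_mono fun t => ?_
  rw [ENNReal.ofReal_max, ENNReal.ofReal_zero, max_eq_left zero_le,
    ← hΦ.setIntegral_mul_divergence]
  exact le_variationIn _ hΦ hΦ1

/-! ### Measurability of the perimeter of the superlevel sets -/

/-- At a level that is attained only on a null set, the pairing of the superlevel set with
`div Φ` is continuous in the level. -/
lemma IsTestFunction.continuousAt_integral_superlevel (hΦ : IsTestFunction Ω Φ)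
    (hf : Measurable f) {t : ℝ} (ht : volume {x | f x = t} = 0) :
    ContinuousAt (fun t => ∫ x, (superlevel Ω f t).indicator (fun _ => 1) x * divergence Φ x)
      t := by
  simp_rw [hΦ.indicator_superlevel_mul_divergence]
  refine continuousAt_of_dominated (bound := fun x => ‖divergence Φ x‖) (.of_forall fun s => ?_)
    (.of_forall fun s => .of_forall fun x => ?_) hΦ.integrable_divergence.norm ?_
  · exact ((Measurable.ite (measurableSet_lt measurable_const hf) measurable_const
      measurable_const).mul hΦ.continuous_divergence.measurable).aestronglyMeasurable
  · rw [norm_mul]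
    refine mul_le_of_le_one_left (norm_nonneg _) ?_
    split_ifs <;> simp
  · have hne : ∀ᵐ x, f x ≠ t := by
      rw [ae_iff]; simpa using ht
    filter_upwards [hne] with x hx
    refine ContinuousAt.mul ?_ continuousAt_const
    rcases lt_or_gt_of_ne hx with h | h
    · refine (continuousAt_const (y := (0 : ℝ))).congr ?_
      filter_upwards [lt_mem_nhds h] with s hs
      simp [hs.le.not_gt]
    · refine (continuousAt_const (y := (1 : ℝ))).congr ?_
      filter_upwards [gt_mem_nhds h] with s hs
      simp [hs]

/-- Away from countably many levels the perimeter is a supremum of continuous functions of the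
level, hence lower semicontinuous. -/
theorem aemeasurable_perimeter_superlevel (hf : Measurable f) :
    AEMeasurable (fun t : ℝ => perimeter (superlevel Ω f t) Ω) := by
  set S : Set ℝ := {t : ℝ | 0 < volume {x | f x = t}}ᶜ with hS
  have hc : Sᶜ.Countable := by
    rw [hS, compl_compl]; exact Measure.countable_meas_level_set_pos hf
  have hSm : MeasurableSet S := by simpa using hc.measurableSet.compl
  have hae : ∀ᵐ t : ℝ, t ∈ S := by
    rw [ae_iff]; exact hc.measure_zero _
  rw [← Measure.restrict_eq_self_of_ae_mem hae]
  refine aemeasurable_restrict_of_measurable_subtype hSm (LowerSemicontinuous.measurable ?_)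
  refine lowerSemicontinuous_iSup fun Φ => lowerSemicontinuous_iSup fun hΦ => ?_
  refine Continuous.lowerSemicontinuous (ENNReal.continuous_ofReal.comp ?_)
  simp_rw [hΦ.1.setIntegral_mul_divergence]
  refine continuous_iff_continuousAt.2 fun t => ?_
  exact (hΦ.1.continuousAt_integral_superlevel hf (by
    have := t.2
    simp only [hS, mem_compl_iff, mem_ofPred_eq, not_lt, nonpos_iff_eq_zero] at this
    exact this)).comp
    continuous_subtype_val.continuousAt

end

section

variable {n : ℕ} {Ω : Set (EuclideanSpace ℝ (Fin n))}

/-! ### Mollification and the upper bound for the integral of the perimeters -/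

/-- A smooth approximation of the Heaviside function, steeper for larger `k`. -/
noncomputable def smoothStep (k : ℕ) (s : ℝ) : ℝ := 1 / 2 + Real.arctan ((k + 1) * s) / Real.pi

/-- The derivative of `smoothStep k`, a probability density. -/
noncomputable def smoothStepDeriv (k : ℕ) (s : ℝ) : ℝ :=
  (k + 1) * (1 + ((k + 1) * s) ^ 2)⁻¹ / Real.pi

lemma hasDerivAt_smoothStep (k : ℕ) (s : ℝ) :
    HasDerivAt (smoothStep k) (smoothStepDeriv k s) s := by
  have h := ((((hasDerivAt_id s).const_mul ((k : ℝ) + 1)).arctan).div_const Real.pi).const_add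
    (1 / 2 : ℝ)
  refine h.congr_deriv ?_
  simp [smoothStepDeriv]
  ring

lemma contDiff_smoothStep (k : ℕ) : ContDiff ℝ 1 (smoothStep k) :=
  contDiff_const.add ((contDiff_const.mul contDiff_id).arctan.div_const _)

lemma norm_smoothStep_le (k : ℕ) (s : ℝ) : ‖smoothStep k s‖ ≤ 1 := by
  have h1 := (div_lt_div_iff_of_pos_right Real.pi_pos).2 (Real.arctan_lt_pi_div_two ((k + 1) * s))
  have h2 := (div_lt_div_iff_of_pos_right Real.pi_pos).2
    (Real.neg_pi_div_two_lt_arctan ((k + 1) * s))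
  have h3 : Real.pi / 2 / Real.pi = 1 / 2 := by field_simp
  rw [neg_div, h3] at h2
  rw [h3] at h1
  rw [Real.norm_eq_abs, abs_le]
  unfold smoothStep
  constructor <;> linarith

lemma smoothStepDeriv_nonneg (k : ℕ) (s : ℝ) : 0 ≤ smoothStepDeriv k s := by
  unfold smoothStepDeriv
  positivity

lemma continuous_smoothStepDeriv (k : ℕ) : Continuous (smoothStepDeriv k) := by
  unfold smoothStepDeriv
  have (s : ℝ) : 1 + (((k : ℝ) + 1) * s) ^ 2 ≠ 0 := by positivity
  fun_prop (disch := assumption)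

lemma lintegral_smoothStepDeriv (k : ℕ) (a : ℝ) :
    ∫⁻ t, ENNReal.ofReal (smoothStepDeriv k (a - t)) = 1 := by
  rw [lintegral_sub_left_eq_self (fun s => ENNReal.ofReal (smoothStepDeriv k s)) a]
  have hk : ((k : ℝ) + 1) ≠ 0 := by positivity
  have hint : Integrable (smoothStepDeriv k) :=
    ((integrable_inv_one_add_sq.comp_mul_left' hk).const_mul _).div_const _
  rw [← ofReal_integral_eq_lintegral_ofReal hint (.of_forall fun s => smoothStepDeriv_nonneg k s)]
  unfold smoothStepDeriv
  rw [integral_div, integral_const_mul,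
    Measure.integral_comp_mul_left (fun s : ℝ => (1 + s ^ 2)⁻¹), integral_univ_inv_one_add_sq,
    abs_of_pos (by positivity), smul_eq_mul]
  have := Real.pi_pos.ne'
  field_simp
  simp

lemma tendsto_smoothStep {s : ℕ → ℝ} {a : ℝ} (hs : Filter.Tendsto s Filter.atTop (nhds a))
    (ha : a ≠ 0) :
    Filter.Tendsto (fun k => smoothStep k (s k)) Filter.atTop (nhds (if 0 < a then 1 else 0)) := by
  have hk : Filter.Tendsto (fun k : ℕ => (k : ℝ) + 1) Filter.atTop Filter.atTop :=
    Filter.tendsto_atTop_add_const_right _ _ tendsto_natCast_atTop_atTop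
  have hpi := Real.pi_pos.ne'
  unfold smoothStep
  rcases lt_or_gt_of_ne ha with h | h
  · have h1 := (tendsto_nhds_of_tendsto_nhdsWithin Real.tendsto_arctan_atBot).comp
      (hk.atTop_mul_neg h hs)
    have h2 := (h1.div_const Real.pi).const_add (1 / 2 : ℝ)
    rw [if_neg h.le.not_gt]
    rwa [show (1 : ℝ) / 2 + -(Real.pi / 2) / Real.pi = 0 by field_simp; norm_num] at h2
  · have h1 := (tendsto_nhds_of_tendsto_nhdsWithin Real.tendsto_arctan_atTop).comp
      (hk.atTop_mul_pos h hs)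
    have h2 := (h1.div_const Real.pi).const_add (1 / 2 : ℝ)
    rw [if_pos h]
    rwa [show (1 : ℝ) / 2 + Real.pi / 2 / Real.pi = 1 by field_simp; norm_num] at h2

variable {f : EuclideanSpace ℝ (Fin n) → ℝ}
  {Φ : EuclideanSpace ℝ (Fin n) → EuclideanSpace ℝ (Fin n)}
  {D : VectorMeasure (EuclideanSpace ℝ (Fin n)) (EuclideanSpace ℝ (Fin n))}

/-- At points whose mollification kernel is supported in `Ω`, the differential of the
mollification of `f` is the mollification of the gradient measure of `f`. -/
lemma IsGradientMeasure.enorm_fderiv_convolution_le (hD : IsGradientMeasure Ω f D)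
    (hΩ : IsOpen Ω) (hfi : Integrable f) (hf0 : ∀ x ∉ Ω, f x = 0)
    {ρ : EuclideanSpace ℝ (Fin n) → ℝ} (hρ : ContDiff ℝ ∞ ρ) (hρc : HasCompactSupport ρ)
    {x : EuclideanSpace ℝ (Fin n)} (hx : ∀ y, x - y ∈ tsupport ρ → y ∈ Ω) :
    ‖fderiv ℝ (convolution ρ f (ContinuousLinearMap.lsmul ℝ ℝ) volume) x‖ₑ ≤
      ∫⁻ y in Ω, ‖ρ (x - y)‖ₑ ∂D.variation := by
  set φ : EuclideanSpace ℝ (Fin n) → ℝ := fun y => ρ (x - y) with hφ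
  have hφt : IsTestFunction Ω φ :=
    { contDiff := hρ.comp (contDiff_const.sub contDiff_id)
      hasCompactSupport := hρc.comp_homeomorph (Homeomorph.subLeft x)
      tsupport_subset := fun y hy => hx y
        (tsupport_comp_subset_preimage ρ (continuous_const.sub continuous_id) hy) }
  set G := ∫ᵛ y in Ω, φ y ∂•D with hG
  have hρ1 : ContDiff ℝ 1 ρ := hρ.of_le (by simp)
  have hρd : Differentiable ℝ ρ := hρ1.differentiable (by simp)
  have hfd (v : EuclideanSpace ℝ (Fin n)) :
      fderiv ℝ (convolution ρ f (ContinuousLinearMap.lsmul ℝ ℝ) volume) x v = inner ℝ v G := by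
    rw [(hρc.hasFDerivAt_convolution_left _ hρ1 hfi.locallyIntegrable x).fderiv,
      convolution_eq_swap]
    have hconv : Integrable fun y => ((ContinuousLinearMap.lsmul ℝ ℝ).precompL
        (EuclideanSpace ℝ (Fin n)) (fderiv ℝ ρ (x - y))) (f y) := by
      have h := (hρc.fderiv ℝ).convolutionExists_left
        ((ContinuousLinearMap.lsmul ℝ ℝ : ℝ →L[ℝ] ℝ →L[ℝ] ℝ).precompL (EuclideanSpace ℝ (Fin n)))
        (hρ1.continuous_fderiv (by simp)) hfi.locallyIntegrable x
      exact h.integrable_swap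
    rw [ContinuousLinearMap.integral_apply hconv]
    have hdual := hD.integral_mul_divergence_smul_const
      (hfi.locallyIntegrable.locallyIntegrableOn Ω) hφt v
    rw [setIntegral_eq_integral_of_forall_compl_eq_zero
      fun y hy => by rw [hf0 y hy, zero_mul]] at hdual
    rw [← neg_eq_iff_eq_neg.2 hdual, ← integral_neg]
    refine integral_congr_ae (.of_forall fun y => ?_)
    have hφd : fderiv ℝ φ y = - fderiv ℝ ρ (x - y) := by
      have h := (hρd (x - y)).hasFDerivAt.comp y ((hasFDerivAt_id y).const_sub x)
      have h' : fderiv ℝ φ y = (fderiv ℝ ρ (x - y)).comp (-ContinuousLinearMap.id ℝ _) := h.fderiv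
      rw [h']; ext; simp
    have hdiv : divergence (fun y => φ y • v) y = fderiv ℝ φ y v := by
      rw [divergence_smul_const hφt.differentiable]
      have : v = ∑ i, v i • EuclideanSpace.single i (1 : ℝ) := by
        ext j; simp [Finset.sum_apply, Pi.single_apply]
      conv_rhs => rw [this]
      simp
    simp [hdiv, hφd, mul_comm]
  have hnorm : ‖fderiv ℝ (convolution ρ f (ContinuousLinearMap.lsmul ℝ ℝ) volume) x‖ ≤ ‖G‖ :=
    ContinuousLinearMap.opNorm_le_bound _ (norm_nonneg _) fun v => by
      rw [hfd v, mul_comm]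
      exact norm_inner_le_norm v G
  have hB : ‖ContinuousLinearMap.lsmul ℝ ℝ (E := EuclideanSpace ℝ (Fin n))‖ₑ ≤ 1 := by
    rw [← ofReal_norm, ← ENNReal.ofReal_one]
    exact ENNReal.ofReal_le_ofReal ContinuousLinearMap.opNorm_lsmul_le
  calc _ ≤ ‖G‖ₑ := by
        rw [← ofReal_norm, ← ofReal_norm]; exact ENNReal.ofReal_le_ofReal hnorm
    _ ≤ _ := VectorMeasure.enorm_integral_le_lintegral_enorm
    _ ≤ 1 * ∫⁻ y, ‖φ y‖ₑ ∂(D.restrict Ω).variation := by gcongr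
    _ = _ := by rw [one_mul, VectorMeasure.variation_restrict hΩ.measurableSet]

/-- Mollification does not increase the total mass of the gradient. -/
lemma IsGradientMeasure.lintegral_enorm_fderiv_convolution_le (hD : IsGradientMeasure Ω f D)
    (hΩ : IsOpen Ω) (hfi : Integrable f) (hf0 : ∀ x ∉ Ω, f x = 0)
    {ρ : EuclideanSpace ℝ (Fin n) → ℝ} (hρ : ContDiff ℝ ∞ ρ) (hρc : HasCompactSupport ρ)
    (hρ0 : ∀ x, 0 ≤ ρ x) (hρ1 : ∫ x, ρ x = 1) {K : Set (EuclideanSpace ℝ (Fin n))}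
    (hKm : MeasurableSet K) (hK : ∀ x ∈ K, ∀ y, x - y ∈ tsupport ρ → y ∈ Ω) :
    ∫⁻ x in K, ‖fderiv ℝ (convolution ρ f (ContinuousLinearMap.lsmul ℝ ℝ) volume) x‖ₑ ≤
      D.variation Ω := by
  have hfin : IsFiniteMeasure (D.variation.restrict Ω) := ⟨by simpa using hD.variation_lt_top⟩
  have hρl : ∫⁻ x, ‖ρ x‖ₑ = 1 := by
    rw [← ofReal_integral_norm_eq_lintegral_enorm
      (hρ.continuous.integrable_of_hasCompactSupport hρc)]
    simp_rw [Real.norm_of_nonneg (hρ0 _), hρ1, ENNReal.ofReal_one]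
  calc _ ≤ ∫⁻ x in K, ∫⁻ y in Ω, ‖ρ (x - y)‖ₑ ∂D.variation :=
        setLIntegral_mono' hKm fun x hx =>
          hD.enorm_fderiv_convolution_le hΩ hfi hf0 hρ hρc (hK x hx)
    _ ≤ ∫⁻ x, ∫⁻ y in Ω, ‖ρ (x - y)‖ₑ ∂D.variation := setLIntegral_le_lintegral _ _
    _ = ∫⁻ y in Ω, (∫⁻ x, ‖ρ (x - y)‖ₑ) ∂D.variation := by
        refine lintegral_lintegral_swap (Measurable.aemeasurable ?_)
        exact ((hρ.continuous.comp (continuous_fst.sub continuous_snd)).enorm).measurable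
    _ = D.variation Ω := by
        simp_rw [lintegral_sub_right_eq_self (fun x => ‖ρ x‖ₑ), hρl]
        simp

/-- For a `C¹` function `h`, the total mass of `∇ (smoothStep k ∘ (h - t))`, integrated over all
levels `t`, is the total mass of `∇ h`. -/
lemma lintegral_lintegral_smoothStepDeriv {h : EuclideanSpace ℝ (Fin n) → ℝ}
    (hh : ContDiff ℝ 1 h) (k : ℕ) (K : Set (EuclideanSpace ℝ (Fin n))) :
    Measurable (fun t : ℝ => ∫⁻ x in K,
      ENNReal.ofReal (smoothStepDeriv k (h x - t)) * ‖fderiv ℝ h x‖ₑ) ∧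
    ∫⁻ t : ℝ, ∫⁻ x in K, ENNReal.ofReal (smoothStepDeriv k (h x - t)) * ‖fderiv ℝ h x‖ₑ =
      ∫⁻ x in K, ‖fderiv ℝ h x‖ₑ := by
  have hdh : Continuous (fderiv ℝ h) := hh.continuous_fderiv (by simp)
  have hmeas : Measurable (Function.uncurry fun (t : ℝ) (x : EuclideanSpace ℝ (Fin n)) =>
      ENNReal.ofReal (smoothStepDeriv k (h x - t)) * ‖fderiv ℝ h x‖ₑ) := by
    have h1 : Measurable fun p : ℝ × EuclideanSpace ℝ (Fin n) =>
        ENNReal.ofReal (smoothStepDeriv k (h p.2 - p.1)) :=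
      (ENNReal.continuous_ofReal.comp ((continuous_smoothStepDeriv k).comp
        ((hh.continuous.comp continuous_snd).sub continuous_fst))).measurable
    have h2 : Measurable fun p : ℝ × EuclideanSpace ℝ (Fin n) => ‖fderiv ℝ h p.2‖ₑ :=
      (hdh.comp continuous_snd).enorm.measurable
    exact h1.mul h2
  refine ⟨hmeas.lintegral_prod_right', ?_⟩
  rw [lintegral_lintegral_swap hmeas.aemeasurable]
  refine lintegral_congr fun x => ?_
  rw [lintegral_mul_const' _ _ (by simp), lintegral_smoothStepDeriv, one_mul]

/-- The pairing of `smoothStep k ∘ (h - t)` with `div Φ` is at most the mass of its gradient. -/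
lemma IsTestFunction.ofReal_integral_smoothStep_le (hΦ : IsTestFunction Ω Φ)
    (hΦ1 : ∀ x, ‖Φ x‖ ≤ 1) {K : Set (EuclideanSpace ℝ (Fin n))} (hKm : MeasurableSet K)
    (hK : tsupport Φ ⊆ K) {h : EuclideanSpace ℝ (Fin n) → ℝ} (hh : ContDiff ℝ 1 h) (k : ℕ)
    (t : ℝ) :
    ENNReal.ofReal (∫ x, smoothStep k (h x - t) * divergence Φ x) ≤
      ∫⁻ x in K, ENNReal.ofReal (smoothStepDeriv k (h x - t)) * ‖fderiv ℝ h x‖ₑ := by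
  have hw : ContDiff ℝ 1 fun x => smoothStep k (h x - t) :=
    (contDiff_smoothStep k).comp (hh.sub contDiff_const)
  have hfd (x : EuclideanSpace ℝ (Fin n)) : fderiv ℝ (fun x => smoothStep k (h x - t)) x =
      smoothStepDeriv k (h x - t) • fderiv ℝ h x :=
    (HasDerivAt.comp_hasFDerivAt (h₂ := smoothStep k) (f := fun x => h x - t) x
      (hasDerivAt_smoothStep k (h x - t))
      ((hh.differentiable (by simp) x).hasFDerivAt.sub_const t)).fderiv
  rw [hΦ.integral_mul_divergence hw]
  refine (ENNReal.ofReal_le_ofReal (Real.le_norm_self _)).trans ?_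
  rw [norm_neg, ofReal_norm]
  refine (enorm_integral_le_lintegral_enorm _).trans ?_
  rw [← lintegral_indicator hKm]
  refine lintegral_mono fun x => ?_
  by_cases hx : x ∈ K
  · rw [indicator_of_mem hx, hfd, ← ofReal_norm, ← ofReal_norm,
      ← ENNReal.ofReal_mul (smoothStepDeriv_nonneg _ _)]
    refine ENNReal.ofReal_le_ofReal ?_
    rw [smul_apply, norm_smul, Real.norm_of_nonneg (smoothStepDeriv_nonneg _ _)]
    refine mul_le_mul_of_nonneg_left ?_ (smoothStepDeriv_nonneg _ _)
    exact ((fderiv ℝ h x).le_opNorm _).trans (mul_le_of_le_one_right (norm_nonneg _) (hΦ1 x))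
  · rw [image_eq_zero_of_notMem_tsupport fun h' => hx (hK h')]
    simp

/-- The mollifier at scale `1 / (k + 1)`. -/
noncomputable def mollifier (n k : ℕ) : ContDiffBump (0 : EuclideanSpace ℝ (Fin n)) where
  rIn := 1 / (2 * (k + 1))
  rOut := 1 / (k + 1)
  rIn_pos := by positivity
  rIn_lt_rOut := one_div_lt_one_div_of_lt (by positivity) (by linarith [k.cast_nonneg (α := ℝ)])

/-- The integral of the perimeters of the superlevel sets is at most the total variation of the
gradient. Smoothing both `f` and the Heaviside function replaces the superlevel sets by smooth
functions, whose gradients are controlled by the mollified gradient of `f`; the claim follows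
by Fatou's lemma. -/
theorem IsGradientMeasure.lintegral_perimeter_le (hD : IsGradientMeasure Ω f D)
    (hΩ : IsOpen Ω) (hf : Measurable f) (hfi : Integrable f) (hf0 : ∀ x ∉ Ω, f x = 0) :
    ∫⁻ t : ℝ, perimeter (superlevel Ω f t) Ω ≤ D.variation Ω := by
  set ρ : ℕ → EuclideanSpace ℝ (Fin n) → ℝ := fun k => (mollifier n k).normed volume with hρ
  set h : ℕ → EuclideanSpace ℝ (Fin n) → ℝ :=
    fun k => convolution (ρ k) f (ContinuousLinearMap.lsmul ℝ ℝ) volume with hh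
  -- the points at distance more than `1 / (k + 1)` from the complement of `Ω`
  set K : ℕ → Set (EuclideanSpace ℝ (Fin n)) :=
    fun k => (Metric.cthickening (1 / (k + 1)) Ωᶜ)ᶜ with hK
  have hρs (k : ℕ) : ContDiff ℝ ∞ (ρ k) := (mollifier n k).contDiff_normed
  have hρc (k : ℕ) : HasCompactSupport (ρ k) := (mollifier n k).hasCompactSupport_normed
  have hhs (k : ℕ) : ContDiff ℝ 1 (h k) :=
    (hρc k).contDiff_convolution_left _ ((hρs k).of_le (by simp)) hfi.locallyIntegrable
  have hKm (k : ℕ) : MeasurableSet (K k) := Metric.isClosed_cthickening.measurableSet.compl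
  have hKΩ (k : ℕ) : ∀ x ∈ K k, ∀ y, x - y ∈ tsupport (ρ k) → y ∈ Ω := by
    intro x hx y hy
    by_contra hyΩ
    refine hx (Metric.mem_cthickening_of_dist_le x y _ _ hyΩ ?_)
    rw [hρ] at hy
    simp only [(mollifier n k).tsupport_normed_eq, Metric.mem_closedBall, dist_zero_right] at hy
    rwa [dist_eq_norm]
  set g : ℕ → ℝ → ℝ≥0∞ := fun k t => ∫⁻ x in K k,
    ENNReal.ofReal (smoothStepDeriv k (h k x - t)) * ‖fderiv ℝ (h k) x‖ₑ with hg
  have hgint (k : ℕ) : ∫⁻ t, g k t ≤ D.variation Ω := by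
    rw [hg, (lintegral_lintegral_smoothStepDeriv (hhs k) k (K k)).2]
    exact hD.lintegral_enorm_fderiv_convolution_le hΩ hfi hf0 (hρs k) (hρc k)
      (mollifier n k).nonneg_normed (mollifier n k).integral_normed (hKm k) (hKΩ k)
  have hlim : ∀ᵐ x, Filter.Tendsto (fun k => h k x) Filter.atTop (nhds (f x)) := by
    refine ContDiffBump.ae_convolution_tendsto_right_of_locallyIntegrable (K := 2)
      tendsto_one_div_add_atTop_nhds_zero_nat (.of_forall fun k => ?_) hfi.locallyIntegrable
    simp only [mollifier]
    field_simp
    exact le_rfl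
  have hae : ∀ᵐ t : ℝ, volume {x | f x = t} = 0 := by
    have := (Measure.countable_meas_level_set_pos (μ := volume) hf).measure_zero volume
    rw [ae_iff]
    simpa [pos_iff_ne_zero] using this
  have hle : ∀ᵐ t : ℝ, perimeter (superlevel Ω f t) Ω ≤
      Filter.liminf (fun k => g k t) Filter.atTop := by
    filter_upwards [hae] with t ht
    refine iSup₂_le fun Φ ⟨hΦ, hΦ1⟩ => ?_
    rw [hΦ.setIntegral_mul_divergence]
    simp_rw [hΦ.indicator_superlevel_mul_divergence]
    have hconv : Filter.Tendsto (fun k => ∫ x, smoothStep k (h k x - t) * divergence Φ x)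
        Filter.atTop (nhds (∫ x, (if t < f x then 1 else 0) * divergence Φ x)) := by
      refine tendsto_integral_of_dominated_convergence (fun x => ‖divergence Φ x‖) (fun k => ?_)
        hΦ.integrable_divergence.norm (fun k => .of_forall fun x => ?_) ?_
      · exact (((contDiff_smoothStep k).continuous.comp
          ((hhs k).continuous.sub continuous_const)).mul
          hΦ.continuous_divergence).aestronglyMeasurable
      · rw [norm_mul]
        exact mul_le_of_le_one_left (norm_nonneg _) (norm_smoothStep_le _ _)
      · have hne : ∀ᵐ x, f x ≠ t := by
          rw [ae_iff]; simpa using ht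
        filter_upwards [hlim, hne] with x hx hxt
        have := tendsto_smoothStep (hx.sub_const t) (sub_ne_zero.2 hxt)
        simp only [sub_pos] at this
        exact this.mul_const _
    have hev : ∀ᶠ k in Filter.atTop, tsupport Φ ⊆ K k := by
      obtain ⟨δ, hδ, hdisj⟩ := Disjoint.exists_cthickenings
        (disjoint_compl_right_iff_subset.2 hΦ.tsupport_subset) hΦ.hasCompactSupport
        hΩ.isClosed_compl
      filter_upwards [(tendsto_one_div_add_atTop_nhds_zero_nat (𝕜 := ℝ)).eventually_lt_const hδ]
        with k hk x hx hx'
      exact disjoint_left.1 hdisj (Metric.self_subset_cthickening _ hx)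
        (Metric.cthickening_mono hk.le _ hx')
    rw [← ((ENNReal.continuous_ofReal.tendsto _).comp hconv).liminf_eq]
    refine Filter.liminf_le_liminf ?_
    filter_upwards [hev] with k hk
    exact hΦ.ofReal_integral_smoothStep_le hΦ1 (hKm k) hk (hhs k) k t
  calc _ ≤ ∫⁻ t, Filter.liminf (fun k => g k t) Filter.atTop := lintegral_mono_ae hle
    _ ≤ Filter.liminf (fun k => ∫⁻ t, g k t) Filter.atTop :=
        lintegral_liminf_le fun k => (lintegral_lintegral_smoothStepDeriv (hhs k) k (K k)).1
    _ ≤ D.variation Ω := by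
        refine Filter.liminf_le_of_le (by isBoundedDefault) fun b hb => ?_
        obtain ⟨k, hk⟩ := hb.exists
        exact hk.trans (hgint k)

end

end BVSpace

/-! ### The coarea formula -/

theorem mainTheorem7 {n : ℕ} (Ω : Set (EuclideanSpace ℝ (Fin n))) (hΩ : IsOpen Ω)
    (f : EuclideanSpace ℝ (Fin n) → ℝ) (hf : BVSpace.MemBV Ω f) :
    (∀ᵐ t : ℝ, BVSpace.HasFinitePerimeter (BVSpace.superlevel Ω f t) Ω ∧
      ∃ Dχ : VectorMeasure (EuclideanSpace ℝ (Fin n)) (EuclideanSpace ℝ (Fin n)),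
        BVSpace.IsGradientMeasure Ω ((BVSpace.superlevel Ω f t).indicator fun _ => 1) Dχ ∧
        Dχ.variation Ω = BVSpace.perimeter (BVSpace.superlevel Ω f t) Ω) ∧
    AEMeasurable (fun t : ℝ => BVSpace.perimeter (BVSpace.superlevel Ω f t) Ω) volume ∧
    ∀ Df : VectorMeasure (EuclideanSpace ℝ (Fin n)) (EuclideanSpace ℝ (Fin n)),
      BVSpace.IsGradientMeasure Ω f Df →
        Df.variation Ω = ∫⁻ t : ℝ, BVSpace.perimeter (BVSpace.superlevel Ω f t) Ω := by
  obtain ⟨hfΩ, D, hD⟩ := hf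
  -- a Borel representative of `f` that vanishes outside `Ω`
  set f' : EuclideanSpace ℝ (Fin n) → ℝ := Ω.indicator (hfΩ.1.mk f) with hf'
  have hmeas : Measurable f' := hfΩ.1.stronglyMeasurable_mk.measurable.indicator hΩ.measurableSet
  have hae : f =ᵐ[volume.restrict Ω] f' := by
    filter_upwards [hfΩ.1.ae_eq_mk, ae_restrict_mem hΩ.measurableSet] with x hx hxΩ
    rw [hf', indicator_of_mem hxΩ, hx]
  have hint : Integrable f' :=
    (integrable_indicator_iff hΩ.measurableSet).2 (hfΩ.congr hfΩ.1.ae_eq_mk)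
  have h0 : ∀ x ∉ Ω, f' x = 0 := fun x hx => indicator_of_notMem hx _
  have hset (t : ℝ) : BVSpace.superlevel Ω f t =ᵐ[volume] BVSpace.superlevel Ω f' t := by
    filter_upwards [(ae_restrict_iff' hΩ.measurableSet).1 hae] with x hx
    refine propext (and_congr_right fun hxΩ => ?_)
    rw [hx hxΩ]
  have hind (t : ℝ) : ((BVSpace.superlevel Ω f t).indicator fun _ => (1 : ℝ)) =ᵐ[volume.restrict Ω]
      (BVSpace.superlevel Ω f' t).indicator fun _ => (1 : ℝ) :=
    ae_restrict_of_ae (indicator_ae_eq_of_ae_eq_set (hset t))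
  have hper (t : ℝ) : BVSpace.perimeter (BVSpace.superlevel Ω f t) Ω =
      BVSpace.perimeter (BVSpace.superlevel Ω f' t) Ω := BVSpace.variationIn_congr_ae (hind t)
  have hcoarea : ∀ Df : VectorMeasure (EuclideanSpace ℝ (Fin n)) (EuclideanSpace ℝ (Fin n)),
      BVSpace.IsGradientMeasure Ω f Df →
        Df.variation Ω = ∫⁻ t : ℝ, BVSpace.perimeter (BVSpace.superlevel Ω f t) Ω := by
    intro Df hDf
    have hDf' := hDf.congr_ae hae
    simp_rw [hper]
    exact le_antisymm ((hDf'.variation_le_variationIn hΩ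
      (hint.locallyIntegrable.locallyIntegrableOn Ω)).trans
      (BVSpace.variationIn_le_lintegral_perimeter hmeas hint))
      (hDf'.lintegral_perimeter_le hΩ hmeas hint h0)
  have hperm : AEMeasurable (fun t : ℝ => BVSpace.perimeter (BVSpace.superlevel Ω f t) Ω) := by
    simp_rw [hper]
    exact BVSpace.aemeasurable_perimeter_superlevel hmeas
  refine ⟨?_, hperm, hcoarea⟩
  have hfin : ∀ᵐ t : ℝ, BVSpace.perimeter (BVSpace.superlevel Ω f t) Ω < ⊤ :=
    ae_lt_top' hperm (by rw [← hcoarea D hD]; exact hD.variation_lt_top.ne)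
  filter_upwards [hfin] with t ht
  refine ⟨⟨(BVSpace.measurableSet_superlevel hΩ hmeas t).nullMeasurableSet.congr (hset t).symm,
    ht⟩, ?_⟩
  rw [hper t] at ht ⊢
  obtain ⟨Dχ, hDχ, hvar⟩ := BVSpace.exists_isGradientMeasure hΩ
    (BVSpace.locallyIntegrableOn_indicator_superlevel hΩ hmeas t) ht
  exact ⟨Dχ, hDχ.congr_ae (hind t).symm, hvar⟩
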